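/- **Theorem (GLS-LASSO oracle inequality).** There is an absolute constant $c>0$ such that the following holds. Let $n\ge 1$, $p\ge 2$. Let $X\in\mathbb{R}^{n\times p}$ be a random matrix whose rows are independent with law $N(0,\Sigma)$, where $\Sigma$ is positive definite. Let $u\sim N(0,\sigma_u^2I_n)$ with $\sigma_u>0$ be independent of $X$, let $\beta_0\in\mathbb{R}^p$, let $L_0\in\mathbb{R}^{n\times n}$ be invertible, and let $y=X\beta_0+L_0u$. Let $R=L_0^{-1}$ be the (known) whitening matrix, put $\gamma_n=\|R\|_F^2/(2n)$, and assume $\gamma_n\ge\tfrac12$ and $\|R\|_2\le 2$, where $\|\cdot\|_F$ is the Frobenius norm and $\|\cdot\|_2$ the $\ell_2$ operator norm. (Both hold for the whitening matrix of stationary AR(1) errors, $n\ge2$, for every $|\rho|<1$.) Put $$\sigma_{\max}^2=\max_j\Sigma_{jj},\qquad \delta(n,r)=\sqrt{\frac{\log r}{n}},\qquad K=\max_{i,j}\|X_{ij}\|_{\psi_2}\|u_i\|_{\psi_2},\qquad \tilde\kappa=2^{-5}(1+\gamma_n)^2\,\eta_{\min}^2(\Sigma^{1/2}),$$ where $\|Z\|_{\psi_2}=\inf\{t>0:\mathbb{E}[e^{Z^2/t^2}]\le2\}$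 and $\eta_{\min}(\Sigma^{1/2})$ is the smallest singular value (equivalently, eigenvalue) of the positive semidefinite square root of $\Sigma$. Let $\tau>1$, let $\tilde\lambda\ge 4c^{-1/2}K\,\delta(n,p^\tau)$ be a real number, let $\mathcal S\subseteq\{1,\dots,p\}$ satisfy $$|\mathcal S|\le 3^{-2}2^{-5}\sigma_{\max}^{-2}\,\tilde\kappa\,(\log p)^{-1}n,$$ and suppose that $$n\ge\|R\|_2^2\,\tau\log p\,\max(3^2 2^3,\;2^{-2}c^{-1}).$$ Then, with probability greater than $1-8p^{1-\tau}$, every minimizer $\tilde\beta$ of the GLS-LASSO objective $$\beta\mapsto\frac1{2n}\|R(y-X\beta)\|_2^2+\tilde\lambda\|\beta\|_1$$ over $\mathbb{R}^p$ satisfies $$\|\tilde\beta-\beta_0\|_2^2\le\frac{27|\mathcal S|\tilde\lambda^2}{8\tilde\kappa^2}+\frac{\tilde\lambda\|\beta_{0;\mathcal S^\perp}\|_1}{\tilde\kappa}+\frac{144}{\tilde\kappa}\,\sigma_{\max}^2\,\delta^2(n,p)\,\|\beta_{0;\mathcal S^\perp}\|_1^2,$$ where $\beta_{0;\mathcal S^\perp}$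 is $\beta_0$ with the entries in $\mathcal S$ set to zero. -/

import Mathlib

open MeasureTheory ProbabilityTheory Matrix
open scoped MatrixOrder

noncomputable section

namespace GLSLasso

/-- The `ℓ₁` norm of a vector. -/
def l1Norm {p : ℕ} (v : Fin p → ℝ) : ℝ := ∑ j, |v j|

/-- The square of the `ℓ₂` norm of a vector. -/
def l2NormSq {n : ℕ} (v : Fin n → ℝ) : ℝ := ∑ i, v i ^ 2

/-- The vector `v` with the entries outside `S` set to zero. -/
def restrict {p : ℕ} (S : Finset (Fin p)) (v : Fin p → ℝ) : Fin p → ℝ :=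
  fun j => if j ∈ S then v j else 0

/-- The square of the Frobenius norm of a matrix. -/
def frobNormSq {n : ℕ} (A : Matrix (Fin n) (Fin n) ℝ) : ℝ := ∑ i, ∑ j, A i j ^ 2

/-- The `ℓ₂` operator norm of a matrix. -/
def opNorm {n : ℕ} (A : Matrix (Fin n) (Fin n) ℝ) : ℝ := ‖toEuclideanCLM (𝕜 := ℝ) A‖

/-- The smallest singular value of a square matrix, `inf {‖A v‖₂ : ‖v‖₂ = 1}`. For a positive
semidefinite matrix it is the smallest eigenvalue. -/
def etaMin {p : ℕ} (A : Matrix (Fin p) (Fin p) ℝ) : ℝ :=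
  ⨅ v : Metric.sphere (0 : EuclideanSpace ℝ (Fin p)) 1,
    ‖toEuclideanCLM (𝕜 := ℝ) A (v : EuclideanSpace ℝ (Fin p))‖

/-- The largest diagonal entry `σ_max² = max_j Σ_jj` of a covariance matrix. -/
def sigmaMaxSq {p : ℕ} (Sig : Matrix (Fin p) (Fin p) ℝ) : ℝ := ⨆ j, Sig j j

/-- `γ_n = ‖R‖_F² / (2n)`. -/
def gam {n : ℕ} (R : Matrix (Fin n) (Fin n) ℝ) : ℝ := frobNormSq R / (2 * n)

/-- `κ̃ = 2⁻⁵ (1 + γ_n)² η_min(Σ^{1/2})²`, with `Σ^{1/2}` the positive semidefinite square root. -/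
def kap {n p : ℕ} (R : Matrix (Fin n) (Fin n) ℝ) (Sig : Matrix (Fin p) (Fin p) ℝ) : ℝ :=
  (2 : ℝ)⁻¹ ^ 5 * (1 + gam R) ^ 2 * etaMin (CFC.sqrt Sig) ^ 2

/-- The scaling function `δ(n, r) = √(log r / n)`. -/
def del (n : ℕ) (r : ℝ) : ℝ := √(Real.log r / n)

/-- The sub-Gaussian (`ψ₂`) norm `inf {t > 0 : E exp(Z² / t²) ≤ 2}` of a random variable. The
expectation is an extended nonnegative number, so it is infinite where it diverges. -/
def subGaussianNorm {Ω : Type*} [MeasurableSpace Ω] (P : Measure Ω) (Z : Ω → ℝ) : ℝ :=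
  sInf {t : ℝ | 0 < t ∧ ∫⁻ ω, ENNReal.ofReal (Real.exp (Z ω ^ 2 / t ^ 2)) ∂P ≤ 2}

/-- `K = max_{i,j} ‖X_ij‖_{ψ₂} ‖u_i‖_{ψ₂}`. -/
def subGaussianK {Ω : Type*} [MeasurableSpace Ω] (P : Measure Ω) {n p : ℕ}
    (X : Ω → Matrix (Fin n) (Fin p) ℝ) (u : Ω → Fin n → ℝ) : ℝ :=
  ⨆ ij : Fin n × Fin p,
    subGaussianNorm P (fun ω => X ω ij.1 ij.2) * subGaussianNorm P (fun ω => u ω ij.1)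

/-- `X ∼ N_{n×p}(0, Σ ⊗ I_n)`: the rows of `X` are independent and each has law `N(0, Σ)`. -/
structure IsGaussianDesign {Ω : Type*} [MeasurableSpace Ω] (P : Measure Ω) {n p : ℕ}
    (X : Ω → Matrix (Fin n) (Fin p) ℝ) (Sig : Matrix (Fin p) (Fin p) ℝ) : Prop where
  row_law : ∀ i, HasLaw (fun ω => WithLp.toLp 2 (X ω i)) (multivariateGaussian 0 Sig) P
  rows_indep : iIndepFun (fun i ω => X ω i) P

/-- `u ∼ N(0, σ² I_n)`: the entries of `u` are independent and each has law `N(0, σ²)`. -/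
structure IsGaussianNoise {Ω : Type*} [MeasurableSpace Ω] (P : Measure Ω) {n : ℕ}
    (u : Ω → Fin n → ℝ) (sig : NNReal) : Prop where
  entry_law : ∀ i, HasLaw (fun ω => u ω i) (gaussianReal 0 (sig ^ 2)) P
  entries_indep : iIndepFun (fun i ω => u ω i) P

/-- The GLS-LASSO objective `β ↦ ‖R (y - X β)‖₂² / (2n) + lam ‖β‖₁`. -/
def glsObjective {n p : ℕ} (R : Matrix (Fin n) (Fin n) ℝ) (y : Fin n → ℝ)
    (X : Matrix (Fin n) (Fin p) ℝ) (lam : ℝ) (β : Fin p → ℝ) : ℝ :=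
  1 / (2 * (n : ℝ)) * l2NormSq (R *ᵥ (y - X *ᵥ β)) + lam * l1Norm β

/-- `β` is a GLS-LASSO estimate: a global minimizer of the objective. -/
def IsGLSLasso {n p : ℕ} (R : Matrix (Fin n) (Fin n) ℝ) (y : Fin n → ℝ)
    (X : Matrix (Fin n) (Fin p) ℝ) (lam : ℝ) (β : Fin p → ℝ) : Prop :=
  ∀ b, glsObjective R y X lam β ≤ glsObjective R y X lam b

end GLSLasso

end

/-! Since `R * L₀ = 1`, whitening turns the problem into a LASSO with design W = R X and white noise
u. Put Δ = β - β₀. Comparing the objective at β and at β₀ bounds ‖WΔ‖²/(2n) by ℓ₁ terms, as soon as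
every column of W has small inner product with u (`basic_inequality`). What remains is a lower bound
for ‖WΔ‖² in terms of ‖Δ‖² and ‖Δ‖₁².

For fixed v the entries of X v are i.i.d. N(0, q) with q = vᵀΣv. Diagonalizing RᵀR and using
rotation invariance, ‖R X v‖² is q times a weighted sum of squares of independent standard normals,
with weights at most 4 and total weight ‖R‖_F² = 2γn. Its exponential moments are explicit, and
Chernoff's bound controls both tails.

Uniformity in v comes from Maurey's empirical method in place of a net. A union bound gives ‖W v‖² ≥
γn vᵀΣv for all sums of k signed basis vectors, of which there are at most (2p)^k. Averaging this
over random sums whose terms have mean v/‖v‖₁ extends it to every v, and the variance of the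
sampling costs a multiple of ‖v‖₁²/(k - 1) (`average_bilin_nonneg`, `form_add_l1Norm_sq_nonneg`).
With k of order γn/log p the cost is of order σ_max² (log p) ‖v‖₁².

The noise is handled by conditioning on X (`lintegral_exp_dotProduct_le`). On the intersection of
the three events the rest is real arithmetic (`scalar_oracle_inequality`). -/

namespace GLSLasso

/-! ### Gaussian moment generating functions -/

/-- Tilting the standard normal density by exp(t x²) gives a multiple of the density of N(0, 1/(1 -
2t)). -/
lemma lintegral_exp_mul_sq_gaussianReal {t : ℝ} (ht : 2 * t < 1) :
    ∫⁻ x, ENNReal.ofReal (Real.exp (t * x ^ 2)) ∂gaussianReal 0 1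
      = ENNReal.ofReal (√(1 - 2 * t))⁻¹ := by
  have h1 : 0 < 1 - 2 * t := by linarith
  set v : NNReal := ⟨(1 - 2 * t)⁻¹, by positivity⟩ with hv
  have hv0 : v ≠ 0 := by
    rw [← NNReal.coe_ne_zero]
    exact (inv_pos.2 h1).ne'
  rw [gaussianReal_of_var_ne_zero _ one_ne_zero,
    lintegral_withDensity_eq_lintegral_mul _ (measurable_gaussianPDF _ _) (by fun_prop)]
  have key : ∀ x : ℝ, (gaussianPDF 0 1 * fun x ↦ ENNReal.ofReal (Real.exp (t * x ^ 2))) x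
      = ENNReal.ofReal (√(1 - 2 * t))⁻¹ * gaussianPDF 0 v x := by
    intro x
    simp only [Pi.mul_apply, gaussianPDF, gaussianPDFReal]
    rw [← ENNReal.ofReal_mul (by positivity), ← ENNReal.ofReal_mul (by positivity)]
    congr 1
    have hvc : (v : ℝ) = (1 - 2 * t)⁻¹ := rfl
    rw [mul_assoc, ← Real.exp_add, hvc]
    have e1 : √(2 * Real.pi * (1 - 2 * t)⁻¹) = √(2 * Real.pi) * (√(1 - 2 * t))⁻¹ := by
      rw [Real.sqrt_mul (by positivity), Real.sqrt_inv]
    rw [e1]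
    have e2 : -(x - 0) ^ 2 / (2 * ((1 : NNReal) : ℝ)) + t * x ^ 2
        = -(x - 0) ^ 2 / (2 * (1 - 2 * t)⁻¹) := by
      simp only [NNReal.coe_one]
      field_simp
      ring
    rw [e2]
    have : √(1 - 2 * t) ≠ 0 := (Real.sqrt_pos.2 h1).ne'
    simp only [NNReal.coe_one, mul_one]
    field_simp
  simp_rw [key]
  rw [lintegral_const_mul _ (measurable_gaussianPDF _ _), lintegral_gaussianPDF_eq_one _ hv0,
    mul_one]

lemma lintegral_exp_mul_gaussianReal (v : NNReal) (a : ℝ) :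
    ∫⁻ x, ENNReal.ofReal (Real.exp (a * x)) ∂gaussianReal 0 v
      = ENNReal.ofReal (Real.exp (v * a ^ 2 / 2)) := by
  rw [← ofReal_integral_eq_lintegral_ofReal (integrable_exp_mul_gaussianReal a)
    (Filter.Eventually.of_forall fun _ => (Real.exp_pos _).le)]
  have := congrFun (mgf_fun_id_gaussianReal (μ := 0) (v := v)) a
  rw [mgf] at this
  rw [this]
  simp

lemma lintegral_prod_pi {ι : Type*} [Fintype ι] (μ : ι → Measure ℝ)
    [∀ i, IsProbabilityMeasure (μ i)] (f : ι → ℝ → ENNReal) (hf : ∀ i, Measurable (f i)) :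
    ∫⁻ x, ∏ i, f i (x i) ∂Measure.pi μ = ∏ i, ∫⁻ x, f i x ∂μ i := by
  refine (lintegral_prod_eq_prod_lintegral_of_indepFun (μ := Measure.pi μ) Finset.univ
    (fun i x => f i (x i)) (iIndepFun_pi fun i => (hf i).aemeasurable)
    (fun i => (hf i).comp (measurable_pi_apply i))).trans ?_
  refine Finset.prod_congr rfl fun i _ => ?_
  exact (measurePreserving_eval μ i).lintegral_comp (hf i)

lemma gaussianReal_eq_map_sqrt (q : NNReal) :
    gaussianReal 0 q = (gaussianReal 0 1).map (fun x => √(q : ℝ) * x) := by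
  rw [gaussianReal_map_const_mul]
  congr 1
  · simp
  · ext
    simp

lemma pi_gaussianReal_eq_map_smul (n : ℕ) (q : NNReal) :
    Measure.pi (fun _ : Fin n => gaussianReal 0 q)
      = (Measure.pi (fun _ : Fin n => gaussianReal 0 1)).map (fun z => √(q : ℝ) • z) := by
  have : (fun z : Fin n → ℝ => √(q : ℝ) • z) = fun z i => √(q : ℝ) * z i := by
    ext z i; simp
  have h2 : IsProbabilityMeasure ((gaussianReal 0 1).map (fun x => √(q : ℝ) * x)) := by
    rw [← gaussianReal_eq_map_sqrt]; infer_instance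
  rw [this, Measure.pi_map_pi (fun _ => by fun_prop)]
  rw [gaussianReal_eq_map_sqrt]

/-! ### Laws of linear images of the design -/

lemma hasLaw_pi_of_entries {Ω : Type*} [MeasurableSpace Ω] {P : Measure Ω}
    [IsProbabilityMeasure P] {n : ℕ} {Z : Ω → Fin n → ℝ} {q : NNReal}
    (h : ∀ i, HasLaw (fun ω => Z ω i) (gaussianReal 0 q) P)
    (hind : iIndepFun (fun i ω => Z ω i) P) :
    HasLaw Z (Measure.pi fun _ => gaussianReal 0 q) P where
  aemeasurable := aemeasurable_pi_lambda _ fun i => (h i).aemeasurable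
  map_eq := by
    rw [show Z = fun ω i => Z ω i from rfl,
      (iIndepFun_iff_map_fun_eq_pi_map fun i => (h i).aemeasurable).1 hind]
    simp_rw [(h _).map_eq]

lemma measurePreserving_dotProduct_multivariateGaussian {p : ℕ} {Sig : Matrix (Fin p) (Fin p) ℝ}
    (hS : Sig.PosSemidef) (v : Fin p → ℝ) :
    MeasurePreserving (fun x : EuclideanSpace ℝ (Fin p) => x.ofLp ⬝ᵥ v) (multivariateGaussian 0 Sig)
      (gaussianReal 0 (v ⬝ᵥ Sig *ᵥ v).toNNReal) where
  measurable := by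
    unfold dotProduct
    fun_prop
  map_eq := by
    have h : (fun x : EuclideanSpace ℝ (Fin p) => x.ofLp ⬝ᵥ v)
        = innerSL ℝ (WithLp.toLp 2 v) := by
      ext x
      simp [PiLp.inner_apply, dotProduct]
    rw [h, IsGaussian.map_eq_gaussianReal, ContinuousLinearMap.integral_comp_id_comm]
    · congr 1
      · simp
      · congr 1
        have h2 : (⇑(innerSL ℝ (WithLp.toLp 2 v)) : EuclideanSpace ℝ (Fin p) → ℝ)
          = fun x => inner ℝ (WithLp.toLp 2 v) x := by ext x; simp
        rw [h2, ← covariance_self (by fun_prop), ← covarianceBilin_apply_eq_cov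
          IsGaussian.memLp_two_id, covarianceBilin_multivariateGaussian hS]
    · exact IsGaussian.integrable_id

lemma hasLaw_design_mulVec {Ω : Type*} [MeasurableSpace Ω] {P : Measure Ω}
    [IsProbabilityMeasure P] {n p : ℕ} {X : Ω → Matrix (Fin n) (Fin p) ℝ}
    {Sig : Matrix (Fin p) (Fin p) ℝ} (hS : Sig.PosSemidef) (hX : IsGaussianDesign P X Sig)
    (v : Fin p → ℝ) :
    HasLaw (fun ω => X ω *ᵥ v)
      (Measure.pi fun _ => gaussianReal 0 (v ⬝ᵥ Sig *ᵥ v).toNNReal) P := by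
  refine hasLaw_pi_of_entries (fun i => ?_) ?_
  · exact (measurePreserving_dotProduct_multivariateGaussian hS v).fun_comp_hasLaw (hX.row_law i)
  · exact hX.rows_indep.comp (fun _ x => x ⬝ᵥ v) (fun _ => by unfold dotProduct; fun_prop)

/-! ### The quadratic form of the whitening matrix -/

lemma l2NormSq_nonneg {n : ℕ} (v : Fin n → ℝ) : 0 ≤ l2NormSq v :=
  Finset.sum_nonneg fun _ _ => sq_nonneg _

lemma l2NormSq_eq_dotProduct {n : ℕ} (v : Fin n → ℝ) : l2NormSq v = v ⬝ᵥ v := by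
  simp [l2NormSq, dotProduct, sq]

lemma l2NormSq_smul {n : ℕ} (a : ℝ) (v : Fin n → ℝ) : l2NormSq (a • v) = a ^ 2 * l2NormSq v := by
  simp [l2NormSq, mul_pow, Finset.mul_sum]

lemma norm_sq_eq_l2NormSq {n : ℕ} (w : EuclideanSpace ℝ (Fin n)) : ‖w‖ ^ 2 = l2NormSq w.ofLp :=
  EuclideanSpace.real_norm_sq_eq w

lemma l2NormSq_mulVec_le {n : ℕ} (R : Matrix (Fin n) (Fin n) ℝ) (w : Fin n → ℝ) :
    l2NormSq (R *ᵥ w) ≤ opNorm R ^ 2 * l2NormSq w := by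
  have h := (toEuclideanCLM (𝕜 := ℝ) R).le_opNorm (WithLp.toLp 2 w)
  have h2 := pow_le_pow_left₀ (norm_nonneg _) h 2
  rw [mul_pow, norm_sq_eq_l2NormSq, norm_sq_eq_l2NormSq] at h2
  simpa [opNorm] using h2

lemma exists_orthonormalBasis_l2NormSq_mulVec {n : ℕ} (R : Matrix (Fin n) (Fin n) ℝ) :
    ∃ (b : OrthonormalBasis (Fin n) ℝ (EuclideanSpace ℝ (Fin n))) (d : Fin n → ℝ),
      (∀ x : Fin n → ℝ, l2NormSq (R *ᵥ (∑ i, x i • b i).ofLp) = ∑ i, d i * x i ^ 2) ∧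
      (∀ i, 0 ≤ d i) ∧ (∀ i, d i ≤ opNorm R ^ 2) ∧ ∑ i, d i = frobNormSq R := by
  have hA : (Rᵀ * R).IsHermitian := by
    simpa using Matrix.isHermitian_conjTranspose_mul_self R
  have hform : ∀ x : Fin n → ℝ, l2NormSq (R *ᵥ (∑ i, x i • hA.eigenvectorBasis i).ofLp)
      = ∑ i, hA.eigenvalues i * x i ^ 2 := by
    intro x
    set w := ∑ i, x i • hA.eigenvectorBasis i with hw
    have h1 : l2NormSq (R *ᵥ w.ofLp) = inner ℝ w (toEuclideanCLM (𝕜 := ℝ) (Rᵀ * R) w) := by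
      rw [l2NormSq_eq_dotProduct, dotProduct_mulVec, vecMul_mulVec, ← mulVec_transpose]
      simp [PiLp.inner_apply, dotProduct, mul_comm]
    have h2 : ∀ i, toEuclideanCLM (𝕜 := ℝ) (Rᵀ * R) (hA.eigenvectorBasis i)
        = hA.eigenvalues i • hA.eigenvectorBasis i := by
      intro i
      apply (WithLp.ofLp_injective 2)
      simpa using hA.mulVec_eigenvectorBasis i
    have h3 : toEuclideanCLM (𝕜 := ℝ) (Rᵀ * R) w
        = ∑ i, (x i * hA.eigenvalues i) • hA.eigenvectorBasis i := by
      rw [hw, map_sum]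
      simp_rw [map_smul, h2, smul_smul]
    rw [h1, h3, hw, hA.eigenvectorBasis.orthonormal.inner_sum]
    refine Finset.sum_congr rfl fun i _ => ?_
    simp
    ring
  have heig : ∀ i, hA.eigenvalues i = l2NormSq (R *ᵥ (hA.eigenvectorBasis i).ofLp) := by
    intro i
    have := hform (Pi.single i 1)
    simpa [Pi.single_apply, Finset.sum_ite_eq] using this.symm
  refine ⟨hA.eigenvectorBasis, hA.eigenvalues, hform, fun i => ?_, fun i => ?_, ?_⟩
  · rw [heig]; exact l2NormSq_nonneg _
  · rw [heig]
    refine (l2NormSq_mulVec_le R _).trans_eq ?_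
    rw [← norm_sq_eq_l2NormSq, hA.eigenvectorBasis.norm_eq_one]
    simp
  · have h := hA.trace_eq_sum_eigenvalues
    simp only [RCLike.ofReal_real_eq_id, id_eq] at h
    rw [← h, frobNormSq, Finset.sum_comm]
    simp [Matrix.trace, Matrix.mul_apply, sq]

lemma frobNormSq_le {n : ℕ} (R : Matrix (Fin n) (Fin n) ℝ) :
    frobNormSq R ≤ n * opNorm R ^ 2 := by
  obtain ⟨b, d, -, -, h3, h4⟩ := exists_orthonormalBasis_l2NormSq_mulVec R
  rw [← h4]
  calc ∑ i, d i ≤ ∑ _i : Fin n, opNorm R ^ 2 := Finset.sum_le_sum fun i _ => h3 i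
    _ = _ := by simp

/-- The moment generating function of `‖R z‖₂²` for `z ∼ N(0, q I)`, as a product over the
eigenvalues of `Rᵀ R`. -/
lemma exists_lintegral_exp_l2NormSq_mulVec {n : ℕ} (R : Matrix (Fin n) (Fin n) ℝ) :
    ∃ d : Fin n → ℝ, (∀ i, 0 ≤ d i) ∧ (∀ i, d i ≤ opNorm R ^ 2) ∧ ∑ i, d i = frobNormSq R ∧
      ∀ (q : NNReal) (t : ℝ), (∀ i, 2 * (t * q * d i) < 1) →
        ∫⁻ z, ENNReal.ofReal (Real.exp (t * l2NormSq (R *ᵥ z)))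
            ∂Measure.pi (fun _ : Fin n => gaussianReal 0 q)
          = ∏ i, ENNReal.ofReal (√(1 - 2 * (t * q * d i)))⁻¹ := by
  obtain ⟨b, d, h1, h2, h3, h4⟩ := exists_orthonormalBasis_l2NormSq_mulVec R
  refine ⟨d, h2, h3, h4, fun q t ht => ?_⟩
  have hm : ∀ s : ℝ, Measurable fun z : Fin n → ℝ =>
      ENNReal.ofReal (Real.exp (s * l2NormSq (R *ᵥ z))) := by
    intro s
    unfold l2NormSq mulVec dotProduct
    fun_prop
  -- Rotation invariance: standard normal coordinates in the eigenbasis again give a standard normal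
  -- vector.
  have hrot : (Measure.pi (fun _ : Fin n => gaussianReal 0 1)).map
      (fun x => (∑ i, x i • b i).ofLp) = Measure.pi (fun _ : Fin n => gaussianReal 0 1) := by
    have e1 := stdGaussian_eq_map_pi_orthonormalBasis b
    rw [← map_pi_eq_stdGaussian] at e1
    have e2 := congrArg (fun μ => μ.map (WithLp.ofLp : EuclideanSpace ℝ (Fin n) → Fin n → ℝ)) e1
    simp only at e2
    rw [Measure.map_map (by fun_prop) (by fun_prop), Measure.map_map (by fun_prop) (by fun_prop)]
      at e2
    rw [show (WithLp.ofLp : EuclideanSpace ℝ (Fin n) → Fin n → ℝ) ∘ WithLp.toLp 2 = id from rfl,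
      Measure.map_id] at e2
    exact e2.symm
  rw [pi_gaussianReal_eq_map_smul, lintegral_map (hm t) (by fun_prop)]
  simp_rw [mulVec_smul, l2NormSq_smul, Real.sq_sqrt q.coe_nonneg, ← mul_assoc]
  rw [← hrot, lintegral_map (hm _) (by fun_prop)]
  simp_rw [h1, Finset.mul_sum, Real.exp_sum]
  simp_rw [ENNReal.ofReal_prod_of_nonneg fun _ _ => (Real.exp_pos _).le, ← mul_assoc]
  rw [lintegral_prod_pi _ (fun i x => ENNReal.ofReal (Real.exp (t * q * d i * x ^ 2)))
    (fun i => by fun_prop)]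
  refine Finset.prod_congr rfl fun i _ => ?_
  simpa only [← mul_assoc] using lintegral_exp_mul_sq_gaussianReal (ht i)

lemma lintegral_exp_neg_l2NormSq_mulVec_le {n : ℕ} (hn : n ≠ 0) {R : Matrix (Fin n) (Fin n) ℝ}
    (hR : opNorm R ≤ 2) {q : NNReal} (hq : q ≠ 0) :
    ∫⁻ z, ENNReal.ofReal (Real.exp (-(8 * q : ℝ)⁻¹ * l2NormSq (R *ᵥ z)))
        ∂Measure.pi (fun _ : Fin n => gaussianReal 0 q)
      ≤ ENNReal.ofReal (Real.exp (-(Real.log 2 / 4 * (gam R * n)))) := by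
  obtain ⟨d, h0, h4, hs, h⟩ := exists_lintegral_exp_l2NormSq_mulVec R
  have hR0 : 0 ≤ opNorm R := norm_nonneg _
  have h4' : ∀ i, d i ≤ 4 := fun i => (h4 i).trans (by nlinarith)
  have hq' : (q : ℝ) ≠ 0 := by exact_mod_cast hq
  have e : ∀ i, 2 * (-(8 * q : ℝ)⁻¹ * q * d i) = -(d i / 4) := fun i => by
    field_simp
    ring
  rw [h q _ fun i => by rw [e]; linarith [h0 i]]
  simp_rw [e]
  rw [← ENNReal.ofReal_prod_of_nonneg fun _ _ => by positivity]
  apply ENNReal.ofReal_le_ofReal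
  have hg : gam R * n = (∑ i, d i) / 2 := by
    rw [hs, gam]
    have : (n : ℝ) ≠ 0 := by exact_mod_cast hn
    field_simp
  rw [hg, show -(Real.log 2 / 4 * ((∑ i, d i) / 2)) = ∑ i, -(Real.log 2 / 2 * (d i / 4)) by
    rw [Finset.sum_neg_distrib, ← Finset.mul_sum, ← Finset.sum_div]; ring, Real.exp_sum]
  refine Finset.prod_le_prod (fun _ _ => by positivity) fun i _ => ?_
  rw [Real.exp_neg, sub_neg_eq_add]
  refine inv_anti₀ (Real.exp_pos _) ?_
  apply Real.le_sqrt_of_sq_le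
  rw [← Real.exp_nat_mul]
  -- Bernoulli: 2^x ≤ 1 + x for 0 ≤ x ≤ 1, at x = d i / 4. The range is where `opNorm R ≤ 2` enters.
  have := rpow_one_add_le_one_add_mul_self (s := 1) (by norm_num) (p := d i / 4)
    (by linarith [h0 i]) (by linarith [h4' i])
  rw [mul_one, one_add_one_eq_two, Real.rpow_def_of_pos two_pos] at this
  refine le_trans (le_of_eq ?_) this
  congr 1
  push_cast
  ring

lemma lintegral_exp_l2NormSq_mulVec_le {n : ℕ} (hn : n ≠ 0) {R : Matrix (Fin n) (Fin n) ℝ}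
    (hR : opNorm R ≤ 2) {q : NNReal} {t : ℝ} (ht : 0 ≤ t) (htq : 80 * (t * q) ≤ 1) :
    ∫⁻ z, ENNReal.ofReal (Real.exp (t * l2NormSq (R *ᵥ z)))
        ∂Measure.pi (fun _ : Fin n => gaussianReal 0 q)
      ≤ ENNReal.ofReal (Real.exp (20 / 9 * (t * q) * (gam R * n))) := by
  obtain ⟨d, h0, h4, hs, h⟩ := exists_lintegral_exp_l2NormSq_mulVec R
  have hR0 : 0 ≤ opNorm R := norm_nonneg _
  have h4' : ∀ i, d i ≤ 4 := fun i => (h4 i).trans (by nlinarith)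
  have htq0 : 0 ≤ t * q := mul_nonneg ht q.2
  have hb : ∀ i, 2 * (t * q * d i) ≤ 1 / 10 := fun i => by nlinarith [h0 i, h4' i]
  rw [h q _ fun i => by linarith [hb i]]
  rw [← ENNReal.ofReal_prod_of_nonneg fun _ _ => by positivity]
  apply ENNReal.ofReal_le_ofReal
  have hg : gam R * n = (∑ i, d i) / 2 := by
    rw [hs, gam]
    have : (n : ℝ) ≠ 0 := by exact_mod_cast hn
    field_simp
  rw [hg, show 20 / 9 * (t * q) * ((∑ i, d i) / 2) = ∑ i, 10 / 9 * (t * q * d i) by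
    rw [← Finset.mul_sum, ← Finset.mul_sum]; ring, Real.exp_sum]
  refine Finset.prod_le_prod (fun _ _ => by positivity) fun i _ => ?_
  set x := 2 * (t * q * d i) with hx
  have hx0 : 0 ≤ x := mul_nonneg two_pos.le (mul_nonneg htq0 (h0 i))
  have hx1 : x ≤ 1 / 10 := hb i
  rw [show 10 / 9 * (t * q * d i) = -(-(5 / 9 * x)) by rw [hx]; ring, Real.exp_neg]
  refine inv_anti₀ (Real.exp_pos _) ?_
  apply Real.le_sqrt_of_sq_le
  rw [← Real.exp_nat_mul]
  -- For x in [0, 1/10], (1 - x)(1 + 10x/9) ≥ 1, so 1/(1 - x) ≤ exp(10x/9).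
  have h1 := Real.add_one_le_exp (10 / 9 * x)
  have : ((2 : ℕ) : ℝ) * -(5 / 9 * x) = -(10 / 9 * x) := by push_cast; ring
  rw [this, Real.exp_neg, inv_le_comm₀ (Real.exp_pos _) (by linarith)]
  refine le_trans ?_ h1
  rw [inv_le_comm₀ (by linarith) (by linarith), inv_le_iff_one_le_mul₀ (by linarith)]
  nlinarith

/-! ### Tail bounds -/

lemma measure_ge_le_of_lintegral_exp_le {Ω : Type*} [MeasurableSpace Ω] {P : Measure Ω}
    {f : Ω → ℝ} (hf : AEMeasurable f P) {a b : ℝ}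
    (h : ∫⁻ ω, ENNReal.ofReal (Real.exp (f ω)) ∂P ≤ ENNReal.ofReal (Real.exp b)) :
    P {ω | a ≤ f ω} ≤ ENNReal.ofReal (Real.exp (b - a)) := by
  have hm : AEMeasurable (fun ω => ENNReal.ofReal (Real.exp (f ω))) P :=
    (Real.measurable_exp.comp_aemeasurable hf).ennreal_ofReal
  have h1 := meas_ge_le_lintegral_div hm (ε := ENNReal.ofReal (Real.exp a))
    (by simp [Real.exp_pos]) ENNReal.ofReal_ne_top
  rw [Real.exp_sub, ENNReal.ofReal_div_of_pos (Real.exp_pos a)]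
  refine (measure_mono fun ω hω => ?_).trans (h1.trans (ENNReal.div_le_div_right h _))
  exact ENNReal.ofReal_le_ofReal (Real.exp_le_exp.2 hω)

@[fun_prop]
lemma measurable_mulVec {m n : ℕ} (R : Matrix (Fin m) (Fin n) ℝ) :
    Measurable fun z : Fin n → ℝ => R *ᵥ z := by
  unfold mulVec dotProduct
  fun_prop

@[fun_prop]
lemma measurable_l2NormSq {n : ℕ} : Measurable (l2NormSq : (Fin n → ℝ) → ℝ) := by
  unfold l2NormSq
  fun_prop

section design

variable {Ω : Type*} [MeasurableSpace Ω] {P : Measure Ω} [IsProbabilityMeasure P] {n p : ℕ}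
  {X : Ω → Matrix (Fin n) (Fin p) ℝ} {Sig : Matrix (Fin p) (Fin p) ℝ}
  {R : Matrix (Fin n) (Fin n) ℝ}

/-- Chernoff's bound at half the mean 2γnq, with exponential parameter -1/(8q). The rate, about
0.048, has to beat the entropy of the sparse sums. -/
lemma measure_l2NormSq_lt_le (hn : n ≠ 0) (hS : Sig.PosDef) (hX : IsGaussianDesign P X Sig)
    (hR : opNorm R ≤ 2) (v : Fin p → ℝ) :
    P {ω | l2NormSq (R *ᵥ (X ω *ᵥ v)) < gam R * n * (v ⬝ᵥ Sig *ᵥ v)}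
      ≤ ENNReal.ofReal (Real.exp (-((Real.log 2 / 4 - 1 / 8) * (gam R * n)))) := by
  -- The zero vector does occur later: signed basis vectors in a sparse sum can cancel.
  by_cases hv : v = 0
  · have : {ω | l2NormSq (R *ᵥ (X ω *ᵥ v)) < gam R * n * (v ⬝ᵥ Sig *ᵥ v)} = ∅ := by
      ext ω
      simpa [hv] using l2NormSq_nonneg _
    rw [this, measure_empty]
    exact zero_le
  have hq : 0 < v ⬝ᵥ Sig *ᵥ v := by simpa using hS.dotProduct_mulVec_pos hv
  set q := v ⬝ᵥ Sig *ᵥ v with hqd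
  have hlaw := hasLaw_design_mulVec hS.posSemidef hX v
  rw [← hqd] at hlaw
  have hqc : ((q.toNNReal : NNReal) : ℝ) = q := Real.coe_toNNReal _ hq.le
  have hmgf := lintegral_exp_neg_l2NormSq_mulVec_le hn hR (q := q.toNNReal)
    (by simpa using hq)
  rw [← hlaw.map_eq, lintegral_map' (by fun_prop) hlaw.aemeasurable] at hmgf
  have h := measure_ge_le_of_lintegral_exp_le (a := -(gam R * n / 8))
    (((measurable_l2NormSq.comp (measurable_mulVec R)).comp_aemeasurable
      hlaw.aemeasurable).const_mul _) hmgf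
  refine (measure_mono fun ω hω => ?_).trans (h.trans_eq ?_)
  · simp only [Set.mem_ofPred_eq, Function.comp_apply] at hω ⊢
    rw [hqc, neg_mul, neg_le_neg_iff, inv_mul_le_iff₀ (by positivity)]
    linarith
  · congr 2
    ring

/-- Chernoff's bound at 6/5 of the mean, with parameter 1/(80q); the rate is 3/100 - 1/36 = 1/450.
-/
lemma measure_lt_l2NormSq_le (hn : n ≠ 0) (hS : Sig.PosDef) (hX : IsGaussianDesign P X Sig)
    (hR : opNorm R ≤ 2) {v : Fin p → ℝ} (hv : v ≠ 0) :
    P {ω | 12 / 5 * (gam R * n) * (v ⬝ᵥ Sig *ᵥ v) < l2NormSq (R *ᵥ (X ω *ᵥ v))}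
      ≤ ENNReal.ofReal (Real.exp (-(gam R * n / 450))) := by
  have hq : 0 < v ⬝ᵥ Sig *ᵥ v := by simpa using hS.dotProduct_mulVec_pos hv
  set q := v ⬝ᵥ Sig *ᵥ v with hqd
  have hlaw := hasLaw_design_mulVec hS.posSemidef hX v
  rw [← hqd] at hlaw
  have hqc : ((q.toNNReal : NNReal) : ℝ) = q := Real.coe_toNNReal _ hq.le
  have htq : (80 * q)⁻¹ * (q.toNNReal : ℝ) = 1 / 80 := by
    rw [hqc]
    field_simp
  have hmgf := lintegral_exp_l2NormSq_mulVec_le hn hR (q := q.toNNReal) (t := (80 * q)⁻¹)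
    (by positivity) (by rw [htq]; norm_num)
  rw [htq] at hmgf
  rw [← hlaw.map_eq, lintegral_map' (by fun_prop) hlaw.aemeasurable] at hmgf
  have h := measure_ge_le_of_lintegral_exp_le (a := 3 / 100 * (gam R * n))
    (((measurable_l2NormSq.comp (measurable_mulVec R)).comp_aemeasurable
      hlaw.aemeasurable).const_mul _) hmgf
  refine (measure_mono fun ω hω => ?_).trans (h.trans_eq ?_)
  · simp only [Set.mem_ofPred_eq, Function.comp_apply] at hω ⊢
    rw [le_inv_mul_iff₀ (by positivity)]
    linarith
  · congr 2
    ring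

/-- Given X, the inner product is Gaussian, so integrating out u leaves the exponential moment of ‖R
X v‖² at parameter θ²σ_u²/2. -/
lemma lintegral_exp_dotProduct_le (hn : n ≠ 0) (hS : Sig.PosDef) (hX : IsGaussianDesign P X Sig)
    (hR : opNorm R ≤ 2) {u : Ω → Fin n → ℝ} {sigu : NNReal} (hu : IsGaussianNoise P u sigu)
    (hXu : IndepFun (fun ω i j => X ω i j) u P) (v : Fin p → ℝ) {θ : ℝ}
    (hθ : 40 * (θ ^ 2 * sigu ^ 2 * (v ⬝ᵥ Sig *ᵥ v)) ≤ 1) :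
    ∫⁻ ω, ENNReal.ofReal (Real.exp (θ * ((R *ᵥ (X ω *ᵥ v)) ⬝ᵥ u ω))) ∂P
      ≤ ENNReal.ofReal
        (Real.exp (10 / 9 * (θ ^ 2 * sigu ^ 2 * (v ⬝ᵥ Sig *ᵥ v)) * (gam R * n))) := by
  have hq : 0 ≤ v ⬝ᵥ Sig *ᵥ v := by simpa using hS.posSemidef.dotProduct_mulVec_nonneg v
  set q := v ⬝ᵥ Sig *ᵥ v with hqd
  have hlaw := hasLaw_design_mulVec hS.posSemidef hX v
  rw [← hqd] at hlaw
  have hqc : ((q.toNNReal : NNReal) : ℝ) = q := Real.coe_toNNReal _ hq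
  have hulaw := hasLaw_pi_of_entries hu.entry_law hu.entries_indep
  have hind : IndepFun (fun ω => X ω *ᵥ v) u P := by
    have hm : Measurable fun A : Fin n → Fin p → ℝ => fun i => ∑ j, A i j * v j := by fun_prop
    exact hXu.comp hm measurable_id
  have hprod := (indepFun_iff_map_prod_eq_prod_map_map hlaw.aemeasurable hulaw.aemeasurable).1 hind
  rw [hlaw.map_eq, hulaw.map_eq] at hprod
  have hmeas : Measurable fun z : (Fin n → ℝ) × (Fin n → ℝ) =>
      ENNReal.ofReal (Real.exp (θ * ((R *ᵥ z.1) ⬝ᵥ z.2))) := by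
    unfold mulVec dotProduct
    fun_prop
  have hinner : ∀ w : Fin n → ℝ, ∫⁻ x, ENNReal.ofReal (Real.exp (θ * (w ⬝ᵥ x)))
      ∂Measure.pi (fun _ : Fin n => gaussianReal 0 (sigu ^ 2))
      = ENNReal.ofReal (Real.exp (sigu ^ 2 * θ ^ 2 / 2 * l2NormSq w)) := by
    intro w
    simp_rw [dotProduct, Finset.mul_sum, Real.exp_sum, ← mul_assoc]
    simp_rw [ENNReal.ofReal_prod_of_nonneg fun _ _ => (Real.exp_pos _).le]
    rw [lintegral_prod_pi _ (fun i x => ENNReal.ofReal (Real.exp (θ * w i * x)))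
      (fun i => by fun_prop)]
    simp_rw [lintegral_exp_mul_gaussianReal]
    rw [← ENNReal.ofReal_prod_of_nonneg fun _ _ => (Real.exp_pos _).le, ← Real.exp_sum, l2NormSq,
      Finset.mul_sum]
    congr 2
    refine Finset.sum_congr rfl fun i _ => ?_
    push_cast
    ring
  calc ∫⁻ ω, ENNReal.ofReal (Real.exp (θ * ((R *ᵥ (X ω *ᵥ v)) ⬝ᵥ u ω))) ∂P
      = ∫⁻ z, ENNReal.ofReal (Real.exp (θ * ((R *ᵥ z.1) ⬝ᵥ z.2)))
          ∂P.map (fun ω => (X ω *ᵥ v, u ω)) := by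
        rw [lintegral_map' hmeas.aemeasurable (hlaw.aemeasurable.prodMk hulaw.aemeasurable)]
    _ ≤ _ := by
        rw [hprod, lintegral_prod _ hmeas.aemeasurable]
        simp_rw [hinner]
        refine (lintegral_exp_l2NormSq_mulVec_le hn hR (by positivity) ?_).trans_eq ?_
        · rw [hqc]; linarith
        · rw [hqc]
          congr 2
          ring

end design

/-! ### The sub-Gaussian norm of a Gaussian variable -/

lemma lintegral_exp_sq_div_sq {Ω : Type*} [MeasurableSpace Ω] {P : Measure Ω} {Z : Ω → ℝ}
    {v : NNReal} (hZ : HasLaw Z (gaussianReal 0 v) P) (t : ℝ) :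
    ∫⁻ ω, ENNReal.ofReal (Real.exp (Z ω ^ 2 / t ^ 2)) ∂P
      = ∫⁻ x, ENNReal.ofReal (Real.exp (v / t ^ 2 * x ^ 2)) ∂gaussianReal 0 1 := by
  calc _ = ∫⁻ x, ENNReal.ofReal (Real.exp (x ^ 2 / t ^ 2)) ∂P.map Z :=
        (lintegral_map' (by fun_prop) hZ.aemeasurable).symm
    _ = _ := by
        rw [hZ.map_eq, gaussianReal_eq_map_sqrt, lintegral_map (by fun_prop) (by fun_prop)]
        simp_rw [mul_pow, Real.sq_sqrt v.coe_nonneg, div_mul_eq_mul_div]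

/-- The exact norm is √(8v/3); the standard deviation is a sufficient lower bound. -/
lemma sqrt_le_subGaussianNorm {Ω : Type*} [MeasurableSpace Ω] {P : Measure Ω} {Z : Ω → ℝ}
    {v : NNReal} (hv : v ≠ 0) (hZ : HasLaw Z (gaussianReal 0 v) P) :
    √(v : ℝ) ≤ subGaussianNorm P Z := by
  have hv' : 0 < (v : ℝ) := by exact_mod_cast pos_iff_ne_zero.2 hv
  apply le_csInf
  -- A witness is needed because the infimum of the empty set is 0 by convention; here the
  -- expectation is exactly 2.
  · refine ⟨√(8 / 3 * v), Real.sqrt_pos.2 (by positivity), ?_⟩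
    rw [lintegral_exp_sq_div_sq hZ, Real.sq_sqrt (by positivity),
      show (v : ℝ) / (8 / 3 * v) = 3 / 8 by field_simp,
      lintegral_exp_mul_sq_gaussianReal (by norm_num),
      show (1 - 2 * (3 / 8) : ℝ) = (1 / 2) ^ 2 by norm_num, Real.sqrt_sq (by norm_num)]
    norm_num
  · rintro t ⟨ht, h⟩
    by_contra! hlt
    have h1 : t ^ 2 < v := by
      have := pow_lt_pow_left₀ hlt ht.le two_ne_zero
      rwa [Real.sq_sqrt hv'.le] at this
    -- The ratio exceeds 1, outside the range of the explicit formula; at 15/32 the formula applies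
    -- and gives 4 > 2.
    have h2 : (15 / 32 : ℝ) ≤ v / t ^ 2 := by
      rw [le_div_iff₀ (by positivity)]
      linarith
    rw [lintegral_exp_sq_div_sq hZ] at h
    have h3 : ∫⁻ x, ENNReal.ofReal (Real.exp (15 / 32 * x ^ 2)) ∂gaussianReal 0 1
        ≤ ∫⁻ x, ENNReal.ofReal (Real.exp (v / t ^ 2 * x ^ 2)) ∂gaussianReal 0 1 := by
      refine lintegral_mono fun x => ENNReal.ofReal_le_ofReal (Real.exp_le_exp.2 ?_)
      exact mul_le_mul_of_nonneg_right h2 (sq_nonneg x)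
    have h4 := h3.trans h
    rw [lintegral_exp_mul_sq_gaussianReal (by norm_num),
      show (1 - 2 * (15 / 32) : ℝ) = (1 / 4) ^ 2 by norm_num, Real.sqrt_sq (by norm_num)] at h4
    norm_num at h4

lemma sqrt_mul_le_subGaussianK {Ω : Type*} [MeasurableSpace Ω] {P : Measure Ω} {n p : ℕ}
    (hn : n ≠ 0) {X : Ω → Matrix (Fin n) (Fin p) ℝ} {Sig : Matrix (Fin p) (Fin p) ℝ}
    (hS : Sig.PosDef) (hX : IsGaussianDesign P X Sig) {u : Ω → Fin n → ℝ} {sigu : NNReal}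
    (hsigu : 0 < sigu) (hu : IsGaussianNoise P u sigu) (j : Fin p) :
    √(Sig j j) * sigu ≤ subGaussianK P X u := by
  let i : Fin n := ⟨0, Nat.pos_of_ne_zero hn⟩
  have hd : 0 < Sig j j := hS.diag_pos
  have h1 : √(Sig j j) ≤ subGaussianNorm P (fun ω => X ω i j) := by
    have hlaw : HasLaw (fun ω => X ω i j) (gaussianReal 0 (Sig j j).toNNReal) P := by
      simpa using (measurePreserving_eval_multivariateGaussian hS.posSemidef
        (i := j)).fun_comp_hasLaw (hX.row_law i)
    have := sqrt_le_subGaussianNorm (by simpa using hd) hlaw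
    rwa [Real.coe_toNNReal _ hd.le] at this
  have h2 : (sigu : ℝ) ≤ subGaussianNorm P (fun ω => u ω i) := by
    have := sqrt_le_subGaussianNorm (pow_ne_zero 2 hsigu.ne') (hu.entry_law i)
    rwa [NNReal.coe_pow, Real.sqrt_sq sigu.coe_nonneg] at this
  refine (mul_le_mul h1 h2 sigu.coe_nonneg ((Real.sqrt_nonneg _).trans h1)).trans ?_
  exact le_ciSup (f := fun ij : Fin n × Fin p =>
    subGaussianNorm P (fun ω => X ω ij.1 ij.2) * subGaussianNorm P (fun ω => u ω ij.1))
    (Set.finite_range _).bddAbove (i, j)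

/-! ### Lower bounds for quadratic forms from lower bounds on sparse averages -/

/-- If a quadratic form is nonnegative on all sums `u + ∑ m, e (J m)` with `k` terms, then so is
the average of its values under independent draws of the terms with weights `w`. -/
lemma average_bilin_nonneg {ι V : Type*} [Fintype ι] [AddCommGroup V] [Module ℝ V]
    (B : V →ₗ[ℝ] V →ₗ[ℝ] ℝ) (e : ι → V) (w : ι → ℝ) (hw0 : ∀ a, 0 ≤ w a) (hw1 : ∑ a, w a = 1)
    (k : ℕ) : ∀ u : V,
    (∀ J : Fin k → ι, 0 ≤ B (u + ∑ m, e (J m)) (u + ∑ m, e (J m))) →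
      0 ≤ B (u + (k : ℝ) • ∑ a, w a • e a) (u + (k : ℝ) • ∑ a, w a • e a)
        + k * (∑ a, w a * B (e a) (e a) - B (∑ a, w a • e a) (∑ a, w a • e a)) := by
  induction k with
  | zero => intro u h; simpa using h Fin.elim0
  | succ k ih =>
    intro u h
    set x := ∑ a, w a • e a with hx
    set D := ∑ a, w a * B (e a) (e a) with hD
    have h1 : ∀ a, 0 ≤ B (u + e a + (k : ℝ) • x) (u + e a + (k : ℝ) • x) + k * (D - B x x) := by
      intro a
      refine ih (u + e a) fun J => ?_
      have := h (Fin.cons a J)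
      simpa [Fin.sum_univ_succ, add_assoc] using this
    have h2 := Finset.sum_nonneg fun a (_ : a ∈ Finset.univ) => mul_nonneg (hw0 a) (h1 a)
    -- Conditioning on the first draw: average the induction hypothesis over `a`. The cross terms
    -- average to those of the mean `x`.
    set y := u + (k : ℝ) • x with hy
    have e1 : ∀ a, w a * (B (u + e a + (k : ℝ) • x) (u + e a + (k : ℝ) • x) + k * (D - B x x))
        = w a * (B y y + k * (D - B x x)) + B y (w a • e a) + B (w a • e a) y
          + w a * B (e a) (e a) := by
      intro a
      have : u + e a + (k : ℝ) • x = y + e a := by rw [hy]; abel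
      rw [this]
      simp only [map_add, LinearMap.add_apply, map_smul, LinearMap.smul_apply, smul_eq_mul]
      ring
    simp_rw [e1, Finset.sum_add_distrib, ← Finset.sum_mul, hw1, ← map_sum, ← hD, ← hx, one_mul]
      at h2
    have e2 : ∑ a, B (w a • e a) y = B x y := by
      rw [hx, map_sum, LinearMap.sum_apply]
    rw [e2] at h2
    have e3 : u + ((k + 1 : ℕ) : ℝ) • x = y + x := by
      rw [hy, Nat.cast_succ, add_smul, one_smul, add_assoc]
    rw [e3]
    simp only [map_add, LinearMap.add_apply]
    push_cast
    linarith

/-- The signed standard basis vectors. -/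
def signedBasis {p : ℕ} (a : Fin p × Bool) : Fin p → ℝ := Pi.single a.1 (if a.2 then 1 else -1)

lemma signedBasis_form {p : ℕ} (M : Matrix (Fin p) (Fin p) ℝ) (a : Fin p × Bool) :
    signedBasis a ⬝ᵥ M *ᵥ signedBasis a = M a.1 a.1 := by
  rcases a with ⟨j, _ | _⟩ <;> simp [signedBasis]

lemma l1Norm_nonneg {p : ℕ} (v : Fin p → ℝ) : 0 ≤ l1Norm v :=
  Finset.sum_nonneg fun _ _ => abs_nonneg _

/-- Maurey's argument: draw sign(v_j) e_j with probability |v_j|/‖v‖₁, so that each term has mean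
v/‖v‖₁. Every signed basis vector has form at most `m`, which bounds the variance term; subtracting
the form of the mean turns k² into k(k - 1). -/
lemma form_add_l1Norm_sq_nonneg {p k : ℕ} (hk : 1 ≤ k) (M : Matrix (Fin p) (Fin p) ℝ) {m : ℝ}
    (hm : ∀ j, M j j ≤ m)
    (h : ∀ J : Fin k → Fin p × Bool,
      0 ≤ (∑ i, signedBasis (J i)) ⬝ᵥ M *ᵥ (∑ i, signedBasis (J i)))
    (v : Fin p → ℝ) :
    0 ≤ ((k : ℝ) - 1) * (v ⬝ᵥ M *ᵥ v) + m * l1Norm v ^ 2 := by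
  by_cases hN : l1Norm v = 0
  · have hv : v = 0 := by
      ext j
      have := (Finset.sum_eq_zero_iff_of_nonneg fun i _ => abs_nonneg (v i)).1 hN j
        (Finset.mem_univ j)
      simpa using this
    simp [hv, l1Norm]
  have hNpos : 0 < l1Norm v := lt_of_le_of_ne (l1Norm_nonneg v) (Ne.symm hN)
  set N := l1Norm v with hNd
  let w : Fin p × Bool → ℝ := fun a => if a.2 = decide (0 ≤ v a.1) then |v a.1| / N else 0
  have hw0 : ∀ a, 0 ≤ w a := by
    intro a
    simp only [w]
    split_ifs
    · positivity
    · rfl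
  have hw1 : ∑ a, w a = 1 := by
    rw [Fintype.sum_prod_type]
    have : ∀ j, ∑ b, w (j, b) = |v j| / N := by
      intro j
      by_cases hj : 0 ≤ v j <;> simp [w, hj]
    simp_rw [this]
    rw [← Finset.sum_div]
    exact div_self hN
  have hx : ∑ a, w a • signedBasis a = N⁻¹ • v := by
    rw [Fintype.sum_prod_type]
    have : ∀ j, ∑ b, w (j, b) • signedBasis (j, b) = Pi.single j (N⁻¹ * v j) := by
      intro j
      by_cases hj : 0 ≤ v j
      · simp only [Fintype.sum_bool, w, signedBasis, hj, abs_of_nonneg hj]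
        ext i
        by_cases hi : i = j
        · subst hi; simp; ring
        · simp [hi]
      · simp only [Fintype.sum_bool, w, signedBasis, hj, abs_of_neg (not_le.1 hj)]
        ext i
        by_cases hi : i = j
        · subst hi; simp; ring
        · simp [hi]
    simp_rw [this]
    ext i
    simp [Finset.sum_apply, Pi.single_apply]
  have key := average_bilin_nonneg (Matrix.toLinearMap₂' ℝ M) signedBasis w hw0 hw1 k 0
    (fun J => by
      rw [zero_add, Matrix.toLinearMap₂'_apply']
      exact h J)
  rw [hx] at key
  simp only [zero_add, map_smul, LinearMap.smul_apply, Matrix.toLinearMap₂'_apply', smul_eq_mul,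
    signedBasis_form] at key
  have hD : ∑ a, w a * M a.1 a.1 ≤ m := by
    calc ∑ a, w a * M a.1 a.1 ≤ ∑ a, w a * m :=
          Finset.sum_le_sum fun a _ => mul_le_mul_of_nonneg_left (hm _) (hw0 a)
      _ = m := by rw [← Finset.sum_mul, hw1, one_mul]
  have hk0 : (0 : ℝ) < k := by exact_mod_cast hk
  set F := v ⬝ᵥ M *ᵥ v with hF
  have h3 : 0 ≤ k * (((k : ℝ) - 1) * (N⁻¹ * (N⁻¹ * F)) + m) := by
    nlinarith
  have h4 := nonneg_of_mul_nonneg_right h3 hk0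
  have h5 := mul_nonneg h4 (sq_nonneg N)
  have e : (((k : ℝ) - 1) * (N⁻¹ * (N⁻¹ * F)) + m) * N ^ 2 = ((k : ℝ) - 1) * F + m * N ^ 2 := by
    field_simp
  rwa [e] at h5

/-- Maurey's argument for M = WᵀW - gΣ, whose diagonal is at most (12/5 - 1) g s = 7/5 g s. -/
lemma l2NormSq_mulVec_lower_bound {n p k : ℕ} (hk : 1 ≤ k) {W : Matrix (Fin n) (Fin p) ℝ}
    {Sig : Matrix (Fin p) (Fin p) ℝ} {g s : ℝ} (hg : 0 ≤ g) (hs : ∀ j, Sig j j ≤ s)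
    (hlow : ∀ J : Fin k → Fin p × Bool,
      g * ((∑ i, signedBasis (J i)) ⬝ᵥ Sig *ᵥ (∑ i, signedBasis (J i)))
        ≤ l2NormSq (W *ᵥ ∑ i, signedBasis (J i)))
    (hup : ∀ j, l2NormSq (W *ᵥ Pi.single j 1) ≤ 12 / 5 * g * Sig j j) (v : Fin p → ℝ) :
    0 ≤ ((k : ℝ) - 1) * (l2NormSq (W *ᵥ v) - g * (v ⬝ᵥ Sig *ᵥ v))
      + 7 / 5 * g * s * l1Norm v ^ 2 := by
  have hform : ∀ v : Fin p → ℝ, v ⬝ᵥ (Wᵀ * W - g • Sig) *ᵥ v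
      = l2NormSq (W *ᵥ v) - g * (v ⬝ᵥ Sig *ᵥ v) := by
    intro v
    rw [sub_mulVec, dotProduct_sub, smul_mulVec, dotProduct_smul, smul_eq_mul,
      l2NormSq_eq_dotProduct, ← mulVec_mulVec, dotProduct_mulVec, vecMul_transpose]
  rw [← hform]
  refine form_add_l1Norm_sq_nonneg hk _ (fun j => ?_) (fun J => ?_) v
  · have h1 := hform (Pi.single j 1)
    have h2 : (Pi.single j 1 : Fin p → ℝ) ⬝ᵥ Sig *ᵥ Pi.single j 1 = Sig j j := by simp
    have h3 : (Pi.single j 1 : Fin p → ℝ) ⬝ᵥ (Wᵀ * W - g • Sig) *ᵥ Pi.single j 1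
      = (Wᵀ * W - g • Sig) j j := by simp
    rw [← h3, h1, h2]
    nlinarith [hup j, hs j]
  · rw [hform]
    linarith [hlow J]

/-! ### The smallest singular value -/

lemma dotProduct_mulVec_eq_norm_sqrt_sq {p : ℕ} {Sig : Matrix (Fin p) (Fin p) ℝ}
    (hS : Sig.PosSemidef) (v : EuclideanSpace ℝ (Fin p)) :
    v.ofLp ⬝ᵥ Sig *ᵥ v.ofLp = ‖toEuclideanCLM (𝕜 := ℝ) (CFC.sqrt Sig) v‖ ^ 2 := by
  have hsa : (CFC.sqrt Sig)ᵀ = CFC.sqrt Sig := by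
    have h := (CFC.sqrt_nonneg Sig).isSelfAdjoint.star_eq
    rwa [star_eq_conjTranspose, conjTranspose_eq_transpose_of_trivial] at h
  rw [norm_sq_eq_l2NormSq, l2NormSq_eq_dotProduct, ofLp_toEuclideanCLM]
  nth_rw 1 [← CFC.sqrt_mul_sqrt_self Sig hS.nonneg]
  rw [← mulVec_mulVec, dotProduct_mulVec, ← mulVec_transpose, hsa]

lemma etaMin_nonneg {p : ℕ} (A : Matrix (Fin p) (Fin p) ℝ) : 0 ≤ etaMin A :=
  Real.iInf_nonneg fun _ => norm_nonneg _

lemma etaMin_mul_norm_le {p : ℕ} (A : Matrix (Fin p) (Fin p) ℝ) (v : EuclideanSpace ℝ (Fin p)) :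
    etaMin A * ‖v‖ ≤ ‖toEuclideanCLM (𝕜 := ℝ) A v‖ := by
  by_cases hv : v = 0
  · simp [hv]
  have hv0 : 0 < ‖v‖ := norm_pos_iff.2 hv
  let w : Metric.sphere (0 : EuclideanSpace ℝ (Fin p)) 1 := ⟨‖v‖⁻¹ • v, by
    simp [norm_smul, hv0.ne']⟩
  have h : etaMin A ≤ ‖toEuclideanCLM (𝕜 := ℝ) A (w : EuclideanSpace ℝ (Fin p))‖ :=
    ciInf_le ⟨0, by rintro _ ⟨x, rfl⟩; exact norm_nonneg _⟩ w
  rw [map_smul, norm_smul, norm_inv, norm_norm] at h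
  rwa [← le_div_iff₀ hv0, div_eq_inv_mul]

lemma etaMin_sqrt_sq_mul_le {p : ℕ} {Sig : Matrix (Fin p) (Fin p) ℝ} (hS : Sig.PosSemidef)
    (v : Fin p → ℝ) : etaMin (CFC.sqrt Sig) ^ 2 * l2NormSq v ≤ v ⬝ᵥ Sig *ᵥ v := by
  have h1 := dotProduct_mulVec_eq_norm_sqrt_sq hS (WithLp.toLp 2 v)
  have h2 := pow_le_pow_left₀ (mul_nonneg (etaMin_nonneg _) (norm_nonneg _))
    (etaMin_mul_norm_le (CFC.sqrt Sig) (WithLp.toLp 2 v)) 2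
  rw [mul_pow, norm_sq_eq_l2NormSq] at h2
  exact h2.trans_eq h1.symm

lemma etaMin_sqrt_pos {p : ℕ} (hp : p ≠ 0) {Sig : Matrix (Fin p) (Fin p) ℝ} (hS : Sig.PosDef) :
    0 < etaMin (CFC.sqrt Sig) := by
  have : NeZero p := ⟨hp⟩
  have hne : Nonempty (Metric.sphere (0 : EuclideanSpace ℝ (Fin p)) 1) :=
    ⟨⟨EuclideanSpace.single 0 1, by simp⟩⟩
  set T := toEuclideanCLM (𝕜 := ℝ) (CFC.sqrt Sig) with hT
  obtain ⟨w, hwS, hw⟩ := (isCompact_sphere (0 : EuclideanSpace ℝ (Fin p)) 1).exists_isMinOn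
    (Set.nonempty_coe_sort.1 hne) (f := fun v => ‖T v‖) (by fun_prop)
  have hw1 : ‖w‖ = 1 := by simpa using hwS
  have hw0 : w.ofLp ≠ 0 := by
    intro h0
    have : w = 0 := WithLp.ofLp_injective 2 h0
    simp [this] at hw1
  have hpos : 0 < w.ofLp ⬝ᵥ Sig *ᵥ w.ofLp := by simpa using hS.dotProduct_mulVec_pos hw0
  rw [dotProduct_mulVec_eq_norm_sqrt_sq hS.posSemidef] at hpos
  have hTw : 0 < ‖T w‖ := lt_of_le_of_ne (norm_nonneg _) fun h => by simp [T, ← h] at hpos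
  exact hTw.trans_le (le_ciInf fun v => hw v.2)

/-! ### The deterministic oracle inequality -/

lemma l1Norm_restrict_eq {p : ℕ} (S : Finset (Fin p)) (v : Fin p → ℝ) :
    l1Norm (restrict S v) = ∑ j ∈ S, |v j| := by
  rw [l1Norm, ← Finset.sum_subset (Finset.subset_univ S)]
  · exact Finset.sum_congr rfl fun j hj => by simp [restrict, hj]
  · intro j _ hj
    simp [restrict, hj]

lemma l1Norm_restrict_add_compl {p : ℕ} (S : Finset (Fin p)) (v : Fin p → ℝ) :
    l1Norm (restrict S v) + l1Norm (restrict Sᶜ v) = l1Norm v := by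
  rw [l1Norm_restrict_eq, l1Norm_restrict_eq, Finset.sum_add_sum_compl, l1Norm]

lemma l1Norm_restrict_sq_le {p : ℕ} (S : Finset (Fin p)) (v : Fin p → ℝ) :
    l1Norm (restrict S v) ^ 2 ≤ S.card * l2NormSq v := by
  rw [l1Norm_restrict_eq]
  refine sq_sum_le_card_mul_sum_sq.trans ?_
  simp_rw [sq_abs]
  exact mul_le_mul_of_nonneg_left (Finset.sum_le_univ_sum_of_nonneg fun _ => sq_nonneg _)
    (Nat.cast_nonneg _)

/-- Coordinatewise triangle inequalities. Off `S` the error is penalized, up to twice the mass of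
`β₀` there; this yields the approximate cone condition. -/
lemma l1Norm_sub_le {p : ℕ} (S : Finset (Fin p)) (β₀ β : Fin p → ℝ) :
    l1Norm β₀ - l1Norm β ≤ l1Norm (restrict S (β - β₀)) - l1Norm (restrict Sᶜ (β - β₀))
      + 2 * l1Norm (restrict Sᶜ β₀) := by
  simp only [l1Norm]
  rw [Finset.mul_sum, ← Finset.sum_sub_distrib, ← Finset.sum_sub_distrib, ← Finset.sum_add_distrib]
  refine Finset.sum_le_sum fun j _ => ?_
  by_cases hj : j ∈ S
  · simp only [restrict, Finset.mem_compl, hj, Pi.sub_apply, if_true, not_true, if_false, abs_zero]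
    have := abs_sub_abs_le_abs_sub (β₀ j) (β j)
    rw [abs_sub_comm] at this
    linarith
  · simp only [restrict, Finset.mem_compl, hj, Pi.sub_apply, not_false_eq_true, if_true, if_false,
      abs_zero]
    have := abs_sub (β j) (β₀ j)
    linarith

lemma basic_inequality {n p : ℕ} (hn : n ≠ 0) {W : Matrix (Fin n) (Fin p) ℝ} {u : Fin n → ℝ}
    {β₀ β : Fin p → ℝ} {lam : ℝ} (S : Finset (Fin p))
    (hmin : 1 / (2 * (n : ℝ)) * l2NormSq (u - W *ᵥ (β - β₀)) + lam * l1Norm β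
      ≤ 1 / (2 * (n : ℝ)) * l2NormSq u + lam * l1Norm β₀)
    (hlam : 0 ≤ lam)
    (hnoise : ∀ j, |(W *ᵥ Pi.single j 1) ⬝ᵥ u| ≤ n * lam / 100) :
    l2NormSq (W *ᵥ (β - β₀)) / n / 2
      ≤ lam * (101 / 100 * l1Norm (restrict S (β - β₀)) - 99 / 100 * l1Norm (restrict Sᶜ (β - β₀))
        + 2 * l1Norm (restrict Sᶜ β₀)) := by
  set Δ := β - β₀ with hΔ
  have hn0 : (0 : ℝ) < n := by exact_mod_cast Nat.pos_of_ne_zero hn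
  have hexp : l2NormSq (u - W *ᵥ Δ) = l2NormSq u - 2 * ((W *ᵥ Δ) ⬝ᵥ u) + l2NormSq (W *ᵥ Δ) := by
    simp only [l2NormSq_eq_dotProduct, sub_dotProduct, dotProduct_sub]
    rw [dotProduct_comm u (W *ᵥ Δ)]
    ring
  have hcross : (W *ᵥ Δ) ⬝ᵥ u ≤ n * lam / 100 * l1Norm Δ := by
    have e : (W *ᵥ Δ) ⬝ᵥ u = ∑ j, Δ j * ((W *ᵥ Pi.single j 1) ⬝ᵥ u) := by
      rw [dotProduct_comm, dotProduct_mulVec, dotProduct_comm, dotProduct]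
      refine Finset.sum_congr rfl fun j _ => ?_
      rw [dotProduct_comm (W *ᵥ _), dotProduct_mulVec, dotProduct_single, mul_one]
    rw [e, l1Norm, Finset.mul_sum]
    refine Finset.sum_le_sum fun j _ => ?_
    calc Δ j * ((W *ᵥ Pi.single j 1) ⬝ᵥ u) ≤ |Δ j| * |(W *ᵥ Pi.single j 1) ⬝ᵥ u| := by
          rw [← abs_mul]; exact le_abs_self _
      _ ≤ |Δ j| * (n * lam / 100) := mul_le_mul_of_nonneg_left (hnoise j) (abs_nonneg _)
      _ = _ := mul_comm _ _
  have hl1 := mul_le_mul_of_nonneg_left (l1Norm_sub_le S β₀ β) hlam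
  rw [← hΔ] at hl1
  have hsplit := l1Norm_restrict_add_compl S Δ
  rw [hexp] at hmin
  have h1 : l2NormSq (W *ᵥ Δ) / n / 2 ≤ 1 / n * ((W *ᵥ Δ) ⬝ᵥ u) + lam * (l1Norm β₀ - l1Norm β) := by
    have : 1 / (2 * (n : ℝ)) * (l2NormSq u - 2 * ((W *ᵥ Δ) ⬝ᵥ u) + l2NormSq (W *ᵥ Δ))
      = 1 / (2 * (n : ℝ)) * l2NormSq u - 1 / n * ((W *ᵥ Δ) ⬝ᵥ u) + l2NormSq (W *ᵥ Δ) / n / 2 := by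
      field_simp
    linarith
  have h2 : 1 / n * ((W *ᵥ Δ) ⬝ᵥ u) ≤ lam / 100 * l1Norm Δ := by
    calc 1 / n * ((W *ᵥ Δ) ⬝ᵥ u) ≤ 1 / n * (n * lam / 100 * l1Norm Δ) :=
          mul_le_mul_of_nonneg_left hcross (by positivity)
      _ = _ := by field_simp
  rw [← hsplit] at h2
  linarith

/-- Here A and C are the ℓ₁ norms of Δ on S and off S, B that of β₀ off S, D = ‖Δ‖², Q = ‖WΔ‖²/n and
σ = σ_max² log p / n. Nonnegativity of the right side of `hbasic` gives the cone condition `h1`,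
which trades the ℓ₁ penalty for A² and B². The A² part is absorbed into κD, since sσ is small. -/
lemma scalar_oracle_inequality {A C B D s lam Q σ κ g : ℝ} (hA : 0 ≤ A) (hC : 0 ≤ C)
    (hD : 0 ≤ D) (hs : 0 ≤ s) (hlam : 0 < lam) (hQ : 0 ≤ Q) (hσ : 0 ≤ σ) (hκ : 0 < κ)
    (hbasic : Q / 2 ≤ lam * (101 / 100 * A - 99 / 100 * C + 2 * B)) (hAD : A ^ 2 ≤ s * D)
    (hre : g * D - 336 / 5 * σ * (A + C) ^ 2 ≤ Q) (hg : 64 / 9 * κ ≤ g) (hsσ : s * σ ≤ κ / 288) :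
    D ≤ 27 * s * lam ^ 2 / (8 * κ ^ 2) + lam * B / κ + 144 / κ * σ * B ^ 2 := by
  have h1 : 99 / 100 * (A + C) ≤ 2 * (A + B) := by
    have : 0 ≤ 101 / 100 * A - 99 / 100 * C + 2 * B :=
      nonneg_of_mul_nonneg_right (le_trans (by linarith) hbasic) hlam
    linarith
  have h2 : (A + C) ^ 2 ≤ 8 * (A ^ 2 + B ^ 2) / (99 / 100) ^ 2 := by
    have h3 := pow_le_pow_left₀ (by positivity) h1 2
    rw [le_div_iff₀ (by norm_num)]
    nlinarith [sq_nonneg (A - B)]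
  have h3 : 336 / 5 * σ * (A + C) ^ 2 ≤ 576 * σ * (A ^ 2 + B ^ 2) := by
    have h4 := mul_le_mul_of_nonneg_left h2 hσ
    have h5 : 0 ≤ σ * (A ^ 2 + B ^ 2) := by positivity
    have : σ * (8 * (A ^ 2 + B ^ 2) / (99 / 100) ^ 2)
        = 80000 / 9801 * (σ * (A ^ 2 + B ^ 2)) := by ring
    rw [this] at h4
    nlinarith
  have h4 : σ * A ^ 2 ≤ κ / 288 * D := by
    calc σ * A ^ 2 ≤ σ * (s * D) := mul_le_mul_of_nonneg_left hAD hσ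
      _ = s * σ * D := by ring
      _ ≤ _ := mul_le_mul_of_nonneg_right hsσ hD
  -- 64/9 - 2 = 46/9, where 2 = 576/288. Young's inequality in `h8` spends a further 10/9, leaving
  -- 4κD.
  have h5 : 46 / 9 * κ * D - 576 * σ * B ^ 2 ≤ Q := by
    have := mul_le_mul_of_nonneg_right hg hD
    linarith
  have h6 : A ≤ √s * √D := by
    rw [← Real.sqrt_mul hs]
    exact Real.le_sqrt_of_sq_le hAD
  have h7 : Q ≤ 101 / 50 * lam * A + 4 * lam * B := by nlinarith [mul_nonneg hlam.le hC]
  have h8 : 101 / 50 * lam * A ≤ 10 / 9 * κ * D + 27 / 2 * (s * lam ^ 2 / κ) := by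
    have e1 := Real.sq_sqrt hs
    have e2 := Real.sq_sqrt hD
    have h9 : 101 / 50 * lam * A ≤ 101 / 50 * lam * (√s * √D) :=
      mul_le_mul_of_nonneg_left h6 (by positivity)
    refine h9.trans ?_
    rw [show 10 / 9 * κ * D + 27 / 2 * (s * lam ^ 2 / κ)
      = (10 / 9 * κ ^ 2 * D + 27 / 2 * (s * lam ^ 2)) / κ by field_simp, le_div_iff₀ hκ]
    have h10 := sq_nonneg (κ * √D - lam * √s)
    have h11 : (κ * √D - lam * √s) ^ 2 = κ ^ 2 * D - 2 * (κ * lam * (√s * √D)) + lam ^ 2 * s := by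
      rw [← e1, ← e2, Real.sqrt_sq (Real.sqrt_nonneg _), Real.sqrt_sq (Real.sqrt_nonneg _)]
      ring
    have h12 : 0 ≤ κ ^ 2 * D := by positivity
    have h13 : 0 ≤ lam ^ 2 * s := by positivity
    linarith
  have h9 : 4 * κ * D ≤ 27 / 2 * (s * lam ^ 2 / κ) + 4 * lam * B + 576 * σ * B ^ 2 := by linarith
  rw [show 27 * s * lam ^ 2 / (8 * κ ^ 2) + lam * B / κ + 144 / κ * σ * B ^ 2
    = (27 / 2 * (s * lam ^ 2 / κ) + 4 * lam * B + 576 * σ * B ^ 2) / (4 * κ) by field_simp; ring]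
  rw [le_div_iff₀ (by positivity)]
  linarith

lemma glsObjective_eq {n p : ℕ} {R L₀ : Matrix (Fin n) (Fin n) ℝ} (hRL : R * L₀ = 1)
    (X : Matrix (Fin n) (Fin p) ℝ) (u : Fin n → ℝ) (β₀ β : Fin p → ℝ) (lam : ℝ) :
    glsObjective R (X *ᵥ β₀ + L₀ *ᵥ u) X lam β
      = 1 / (2 * (n : ℝ)) * l2NormSq (u - (R * X) *ᵥ (β - β₀)) + lam * l1Norm β := by
  have : R *ᵥ (X *ᵥ β₀ + L₀ *ᵥ u - X *ᵥ β) = u - (R * X) *ᵥ (β - β₀) := by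
    rw [mulVec_sub, mulVec_add, mulVec_mulVec, mulVec_mulVec, mulVec_mulVec, hRL, one_mulVec,
      mulVec_sub]
    abel
  rw [glsObjective, this]

/-! ### The good event -/

/-- Only monotonicity and subadditivity are used, so neither set has to be measurable. This matters
for the event about all minimizers. -/
lemma one_sub_lt_measureReal {Ω : Type*} [MeasurableSpace Ω] {P : Measure Ω}
    [IsProbabilityMeasure P] {T E : Set Ω} (h : Eᶜ ⊆ T) {b B : ℝ} (hb : 0 ≤ b) (hbB : b < B)
    (hE : P E ≤ ENNReal.ofReal b) : 1 - B < P.real T := by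
  have h1 : P.real E ≤ b := ENNReal.toReal_le_of_le_ofReal hb hE
  have h2 : (1 : ℝ) ≤ P.real T + P.real E := by
    rw [← probReal_univ (μ := P)]
    refine (measureReal_mono fun ω _ => ?_).trans (measureReal_union_le T E)
    by_cases hω : ω ∈ E
    · exact Or.inr hω
    · exact Or.inl (h hω)
  linarith

lemma measure_iUnion_fintype_le_card_mul {Ω ι : Type*} [MeasurableSpace Ω] [Fintype ι]
    {P : Measure Ω} {E : ι → Set Ω} {b : ℝ} {r : ENNReal}
    (h : ∀ i, P (E i) ≤ ENNReal.ofReal b) (hr : ENNReal.ofReal (Fintype.card ι * b) ≤ r) :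
    P (⋃ i, E i) ≤ r := by
  refine (measure_iUnion_fintype_le P E).trans (le_trans ?_ hr)
  refine (Finset.sum_le_sum fun i _ => h i).trans_eq ?_
  rw [Finset.sum_const, nsmul_eq_mul, ENNReal.ofReal_mul (Nat.cast_nonneg _),
    ENNReal.ofReal_natCast, Finset.card_univ]

lemma del_sq {n : ℕ} {r : ℝ} (hr : 1 ≤ r) : del n r ^ 2 = Real.log r / n :=
  Real.sq_sqrt (div_nonneg (Real.log_nonneg hr) (Nat.cast_nonneg n))

lemma gam_le_two {n : ℕ} (hn : n ≠ 0) {R : Matrix (Fin n) (Fin n) ℝ} (hR : opNorm R ≤ 2) :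
    gam R ≤ 2 := by
  have hn0 : (0 : ℝ) < n := by exact_mod_cast Nat.pos_of_ne_zero hn
  have h0 : 0 ≤ opNorm R := norm_nonneg _
  rw [gam, div_le_iff₀ (by positivity)]
  have h1 := frobNormSq_le R
  have h2 : opNorm R ^ 2 ≤ 4 := by nlinarith
  nlinarith

lemma two_mul_gam_le_opNorm_sq {n : ℕ} (hn : n ≠ 0) (R : Matrix (Fin n) (Fin n) ℝ) :
    2 * gam R ≤ opNorm R ^ 2 := by
  have hn0 : (0 : ℝ) < n := by exact_mod_cast Nat.pos_of_ne_zero hn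
  rw [gam, show 2 * (frobNormSq R / (2 * n)) = frobNormSq R / n by field_simp,
    div_le_iff₀ hn0, mul_comm]
  exact frobNormSq_le R

/-- For n = 0 the quotient defining `gam` is 0/0 = 0. -/
lemma ne_zero_of_half_le_gam {n : ℕ} {R : Matrix (Fin n) (Fin n) ℝ} (h : 1 / 2 ≤ gam R) :
    n ≠ 0 := by
  rintro rfl
  simp [gam] at h
  norm_num at h

/-- The number of terms in the sparse averages over which the union bound is taken. -/
noncomputable def numTerms {n : ℕ} (R : Matrix (Fin n) (Fin n) ℝ) (p : ℕ) : ℕ :=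
  ⌈gam R * n / (48 * Real.log p)⌉₊ + 1

lemma aemeasurable_mulVec_dotProduct {Ω : Type*} [MeasurableSpace Ω] {P : Measure Ω}
    {n : ℕ} (R : Matrix (Fin n) (Fin n) ℝ) {z u : Ω → Fin n → ℝ}
    (hz : AEMeasurable z P) (hu : AEMeasurable u P) :
    AEMeasurable (fun ω => (R *ᵥ z ω) ⬝ᵥ u ω) P := by
  have hRz := (measurable_mulVec R).comp_aemeasurable hz
  exact Finset.aemeasurable_fun_sum _ fun i _ =>
    (((measurable_pi_apply i).comp_aemeasurable hRz).mul
      ((measurable_pi_apply i).comp_aemeasurable hu))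

section design

variable {Ω : Type*} [MeasurableSpace Ω] {P : Measure Ω} [IsProbabilityMeasure P] {n p : ℕ}
  {X : Ω → Matrix (Fin n) (Fin p) ℝ} {Sig : Matrix (Fin p) (Fin p) ℝ}
  {R : Matrix (Fin n) (Fin n) ℝ} {τ : ℝ}

lemma measure_exists_l2NormSq_lt_le (hp : 2 ≤ p) (hS : Sig.PosDef)
    (hX : IsGaussianDesign P X Sig) (hγ : 1 / 2 ≤ gam R) (hR : opNorm R ≤ 2) (hτ : 1 < τ)
    (hlarge : 2500 * (τ * Real.log p) ≤ n) :
    P (⋃ J : Fin (numTerms R p) → Fin p × Bool,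
      {ω | l2NormSq (R *ᵥ (X ω *ᵥ ∑ i, signedBasis (J i)))
        < gam R * n * ((∑ i, signedBasis (J i)) ⬝ᵥ Sig *ᵥ ∑ i, signedBasis (J i))})
      ≤ ENNReal.ofReal ((p : ℝ) ^ (1 - τ)) := by
  have hn := ne_zero_of_half_le_gam hγ
  refine measure_iUnion_fintype_le_card_mul
    (fun J => measure_l2NormSq_lt_le hn hS hX hR (∑ i, signedBasis (J i))) ?_
  apply ENNReal.ofReal_le_ofReal
  have hp0 : (0 : ℝ) < p := by positivity
  have hp2 : (2 : ℝ) ≤ p := by exact_mod_cast hp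
  have hl2 := Real.log_two_gt_d9
  have hlp : Real.log 2 ≤ Real.log p := Real.log_le_log two_pos hp2
  have hl : 0 < Real.log p := by linarith
  have hcard : (Fintype.card (Fin (numTerms R p) → Fin p × Bool) : ℝ)
      = Real.exp (numTerms R p * (Real.log p + Real.log 2)) := by
    rw [← Real.log_mul hp0.ne' two_ne_zero, Real.exp_nat_mul, Real.exp_log (by positivity)]
    simp
  rw [hcard, ← Real.exp_add, Real.rpow_def_of_pos hp0]
  apply Real.exp_le_exp.2
  have hk : (numTerms R p : ℝ) ≤ gam R * n / (48 * Real.log p) + 2 := by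
    have := Nat.ceil_lt_add_one (a := gam R * n / (48 * Real.log p)) (by positivity)
    rw [numTerms]
    push_cast
    linarith
  -- The entropy rate 1/24 ≈ 0.0417 stays below the tail rate 0.0482. This is why `numTerms` has 48,
  -- and the gap pays for the multiples of log p.
  have h1 : (numTerms R p : ℝ) * (Real.log p + Real.log 2) ≤ gam R * n / 24 + 4 * Real.log p := by
    calc (numTerms R p : ℝ) * (Real.log p + Real.log 2)
        ≤ (gam R * n / (48 * Real.log p) + 2) * (2 * Real.log p) :=
          mul_le_mul hk (by linarith) (by linarith [Real.log_pos one_lt_two]) (by positivity)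
      _ = _ := by field_simp; ring
  have h2 : 1250 * (τ * Real.log p) ≤ gam R * n := by
    have : 1 / 2 * (n : ℝ) ≤ gam R * n := mul_le_mul_of_nonneg_right hγ (Nat.cast_nonneg n)
    linarith
  have h3 : Real.log p ≤ τ * Real.log p := by nlinarith
  have h4 : 0.0482 * (gam R * n) ≤ (Real.log 2 / 4 - 1 / 8) * (gam R * n) :=
    mul_le_mul_of_nonneg_right (by linarith) (by nlinarith)
  linarith

lemma measure_exists_lt_l2NormSq_le (hp : 2 ≤ p) (hS : Sig.PosDef)
    (hX : IsGaussianDesign P X Sig) (hγ : 1 / 2 ≤ gam R) (hR : opNorm R ≤ 2)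
    (hlarge : 2500 * (τ * Real.log p) ≤ n) :
    P (⋃ j : Fin p, {ω | 12 / 5 * (gam R * n) * Sig j j
        < l2NormSq (R *ᵥ (X ω *ᵥ Pi.single j 1))})
      ≤ ENNReal.ofReal ((p : ℝ) ^ (1 - τ)) := by
  have hn := ne_zero_of_half_le_gam hγ
  have hp0 : (0 : ℝ) < p := by positivity
  have hl : 0 < Real.log p := Real.log_pos (by exact_mod_cast hp)
  refine measure_iUnion_fintype_le_card_mul (b := Real.exp (-(gam R * n / 450))) (fun j => ?_) ?_
  · have h := measure_lt_l2NormSq_le hn hS hX hR (v := Pi.single j 1)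
      (by intro h; simpa using congrFun h j)
    simpa using h
  apply ENNReal.ofReal_le_ofReal
  rw [Fintype.card_fin]
  nth_rw 1 [← Real.exp_log hp0]
  rw [← Real.exp_add, Real.rpow_def_of_pos hp0]
  apply Real.exp_le_exp.2
  have h2 : 1250 * (τ * Real.log p) ≤ gam R * n := by
    have : 1 / 2 * (n : ℝ) ≤ gam R * n := mul_le_mul_of_nonneg_right hγ (Nat.cast_nonneg n)
    linarith
  nlinarith

lemma measure_exists_lt_abs_dotProduct_le (hp : 2 ≤ p) (hS : Sig.PosDef)
    (hX : IsGaussianDesign P X Sig) (hγ : 1 / 2 ≤ gam R) (hR : opNorm R ≤ 2) (hτ : 1 < τ)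
    (hlarge : 2500 * (τ * Real.log p) ≤ n) {u : Ω → Fin n → ℝ} {sigu : NNReal} (hsigu : 0 < sigu)
    (hu : IsGaussianNoise P u sigu) (hXu : IndepFun (fun ω i j => X ω i j) u P) {lam : ℝ}
    (hlam : ∀ j, 400 * (√(Sig j j) * sigu) * del n ((p : ℝ) ^ τ) ≤ lam) :
    P (⋃ j : Fin p, {ω | n * lam / 100 < |(R *ᵥ (X ω *ᵥ Pi.single j 1)) ⬝ᵥ u ω|})
      ≤ ENNReal.ofReal (2 * (p : ℝ) ^ (1 - τ)) := by
  have hn := ne_zero_of_half_le_gam hγ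
  have hn0 : (0 : ℝ) < n := by exact_mod_cast Nat.pos_of_ne_zero hn
  have hp0 : (0 : ℝ) < p := by positivity
  have hl : 0 < Real.log p := Real.log_pos (by exact_mod_cast hp)
  have hγ2 := gam_le_two hn hR
  have hδ : del n ((p : ℝ) ^ τ) ^ 2 = τ * Real.log p / n := by
    rw [del_sq (Real.one_le_rpow (by exact_mod_cast (by omega : 1 ≤ p)) (by linarith)),
      Real.log_rpow hp0]
  have hδ0 : 0 ≤ del n ((p : ℝ) ^ τ) := Real.sqrt_nonneg _
  set δ := del n ((p : ℝ) ^ τ) with hδd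
  have hδn : n * δ ^ 2 = τ * Real.log p := by
    rw [hδ]
    field_simp
  have hσ : (0 : ℝ) < sigu := by exact_mod_cast hsigu
  have hlaw := hasLaw_pi_of_entries hu.entry_law hu.entries_indep
  refine measure_iUnion_fintype_le_card_mul (b := 2 * (p : ℝ) ^ (-τ)) (fun j => ?_) ?_
  · have hd : 0 < √(Sig j j) := Real.sqrt_pos.2 hS.diag_pos
    have hform : (Pi.single j 1 : Fin p → ℝ) ⬝ᵥ Sig *ᵥ Pi.single j 1 = Sig j j := by simp
    have hmeas : AEMeasurable (fun ω => (R *ᵥ (X ω *ᵥ Pi.single j 1)) ⬝ᵥ u ω) P :=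
      aemeasurable_mulVec_dotProduct R
        (hasLaw_design_mulVec hS.posSemidef hX (Pi.single j 1)).aemeasurable hlaw.aemeasurable
    set s := √(Sig j j) * sigu with hsd
    have hs : 0 < s := by positivity
    have hs2 : sigu ^ 2 * Sig j j = s ^ 2 := by
      rw [hsd, mul_pow, Real.sq_sqrt hS.diag_pos.le, mul_comm]
    have hlevel : 4 * (τ * Real.log p) ≤ δ / s * (n * lam / 100) := by
      have h1 : δ / s * (n * (400 * s * δ) / 100) ≤ δ / s * (n * lam / 100) := by
        have := hlam j
        gcongr
      refine le_trans (le_of_eq ?_) h1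
      rw [← hδn]
      field_simp
      ring
    -- At this θ the exponential moment costs at most 20/9 τ log p, as γ ≤ 2, against a level of 4 τ
    -- log p. Both signs of θ are needed for the absolute value.
    have htail : ∀ θ : ℝ, θ ^ 2 = (δ / s) ^ 2 →
        P {ω | δ / s * (n * lam / 100) ≤ θ * ((R *ᵥ (X ω *ᵥ Pi.single j 1)) ⬝ᵥ u ω)}
          ≤ ENNReal.ofReal ((p : ℝ) ^ (-τ)) := by
      intro θ hθ
      have hθs : θ ^ 2 * sigu ^ 2 * ((Pi.single j 1 : Fin p → ℝ) ⬝ᵥ Sig *ᵥ Pi.single j 1)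
          = δ ^ 2 := by
        rw [hform, mul_assoc, hs2, hθ]
        field_simp
      have hmgf := lintegral_exp_dotProduct_le hn hS hX hR hu hXu (Pi.single j 1) (θ := θ) (by
        rw [hθs, hδ, mul_div_assoc', div_le_one hn0]
        nlinarith)
      rw [hθs] at hmgf
      refine (measure_ge_le_of_lintegral_exp_le (hmeas.const_mul θ) hmgf).trans ?_
      apply ENNReal.ofReal_le_ofReal
      rw [Real.rpow_def_of_pos hp0]
      apply Real.exp_le_exp.2
      have : 10 / 9 * δ ^ 2 * (gam R * n) ≤ 20 / 9 * (τ * Real.log p) := by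
        rw [← hδn]
        have : 0 ≤ n * δ ^ 2 := by positivity
        nlinarith
      nlinarith
    have h1 := htail (δ / s) rfl
    have h2 := htail (-(δ / s)) (neg_sq _)
    rw [two_mul, ENNReal.ofReal_add (by positivity) (by positivity)]
    refine (measure_mono fun ω hω => ?_).trans ((measure_union_le _ _).trans (add_le_add h1 h2))
    have hδs : 0 ≤ δ / s := by positivity
    rcases lt_abs.1 (show n * lam / 100 < |(R *ᵥ (X ω *ᵥ Pi.single j 1)) ⬝ᵥ u ω| from hω) with h | h
    · left
      exact mul_le_mul_of_nonneg_left h.le hδs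
    · right
      change δ / s * (n * lam / 100) ≤ -(δ / s) * ((R *ᵥ (X ω *ᵥ Pi.single j 1)) ⬝ᵥ u ω)
      rw [neg_mul, ← mul_neg]
      exact mul_le_mul_of_nonneg_left h.le hδs
  · apply ENNReal.ofReal_le_ofReal
    rw [Fintype.card_fin, sub_eq_add_neg, Real.rpow_add hp0, Real.rpow_one]
    apply le_of_eq
    ring

end design

/-! ### The oracle inequality on the good event -/

lemma l2NormSq_sub_le_of_isGLSLasso {n p : ℕ} (hp : 2 ≤ p) {R L₀ : Matrix (Fin n) (Fin n) ℝ}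
    (hRL : R * L₀ = 1) (hγ : 1 / 2 ≤ gam R) (hR : opNorm R ≤ 2) {Sig : Matrix (Fin p) (Fin p) ℝ}
    (hSig : Sig.PosDef) {X : Matrix (Fin n) (Fin p) ℝ} {u : Fin n → ℝ} {β₀ β : Fin p → ℝ}
    {lam : ℝ} (hlam : 0 < lam) {S : Finset (Fin p)}
    (hS : (S.card : ℝ) ≤ (3 : ℝ)⁻¹ ^ 2 * (2 : ℝ)⁻¹ ^ 5 * (sigmaMaxSq Sig)⁻¹ *
      kap R Sig * (Real.log p)⁻¹ * n)
    (hlow : ∀ J : Fin (numTerms R p) → Fin p × Bool,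
      gam R * n * ((∑ i, signedBasis (J i)) ⬝ᵥ Sig *ᵥ ∑ i, signedBasis (J i))
        ≤ l2NormSq (R *ᵥ (X *ᵥ ∑ i, signedBasis (J i))))
    (hup : ∀ j, l2NormSq (R *ᵥ (X *ᵥ Pi.single j 1)) ≤ 12 / 5 * (gam R * n) * Sig j j)
    (hnoise : ∀ j, |(R *ᵥ (X *ᵥ Pi.single j 1)) ⬝ᵥ u| ≤ n * lam / 100)
    (hβ : IsGLSLasso R (X *ᵥ β₀ + L₀ *ᵥ u) X lam β) :
    l2NormSq (β - β₀) ≤ 27 * S.card * lam ^ 2 / (8 * kap R Sig ^ 2)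
      + lam * l1Norm (restrict Sᶜ β₀) / kap R Sig
      + 144 / kap R Sig * sigmaMaxSq Sig * del n p ^ 2 * l1Norm (restrict Sᶜ β₀) ^ 2 := by
  have hn := ne_zero_of_half_le_gam hγ
  have hn0 : (0 : ℝ) < n := by exact_mod_cast Nat.pos_of_ne_zero hn
  have hγ2 := gam_le_two hn hR
  have hl : 0 < Real.log p := Real.log_pos (by exact_mod_cast hp)
  have hη := etaMin_sqrt_pos (by omega) hSig
  have hσ : ∀ j, Sig j j ≤ sigmaMaxSq Sig := fun j =>
    le_ciSup (f := fun j => Sig j j) (Set.finite_range _).bddAbove j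
  have hσ0 : 0 < sigmaMaxSq Sig := lt_of_lt_of_le hSig.diag_pos (hσ ⟨0, by omega⟩)
  have hκ : 0 < kap R Sig := by
    unfold kap
    have : 0 < 1 + gam R := by linarith
    positivity
  set Δ := β - β₀ with hΔ
  have hmin := hβ β₀
  rw [glsObjective_eq hRL, glsObjective_eq hRL, sub_self, mulVec_zero, sub_zero] at hmin
  have hbasic := basic_inequality hn S hmin hlam.le
    (fun j => by simpa only [mulVec_mulVec] using hnoise j)
  have hre := l2NormSq_mulVec_lower_bound (k := numTerms R p) (W := R * X) (Sig := Sig)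
    (g := gam R * n) (Nat.le_add_left _ _) (by positivity) hσ
    (fun J => by simpa only [mulVec_mulVec] using hlow J)
    (fun j => by simpa only [mulVec_mulVec] using hup j) Δ
  rw [mul_assoc (144 / kap R Sig)]
  refine scalar_oracle_inequality (A := l1Norm (restrict S Δ)) (C := l1Norm (restrict Sᶜ Δ))
    (Q := l2NormSq ((R * X) *ᵥ Δ) / n) (g := gam R * etaMin (CFC.sqrt Sig) ^ 2)
    (l1Norm_nonneg _) (l1Norm_nonneg _) (l2NormSq_nonneg _) (Nat.cast_nonneg _) hlam
    (div_nonneg (l2NormSq_nonneg _) hn0.le) (by positivity) hκ hbasic (l1Norm_restrict_sq_le S Δ)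
    ?_ ?_ ?_
  · rw [l1Norm_restrict_add_compl, del_sq (by exact_mod_cast (by omega : 1 ≤ p))]
    -- The extra term in `numTerms` makes up for the factor k - 1 in Maurey's bound; 7/5 · 48 =
    -- 336/5.
    have hm : gam R * n / (48 * Real.log p) ≤ (numTerms R p : ℝ) - 1 := by
      have := Nat.le_ceil (gam R * n / (48 * Real.log p))
      rw [numTerms]
      push_cast
      linarith
    set m := (numTerms R p : ℝ) - 1
    have hg0 : 0 < gam R * n := by positivity
    have hm0 : 0 < m := lt_of_lt_of_le (by positivity) hm
    rw [div_le_iff₀ (by positivity)] at hm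
    have hform := etaMin_sqrt_sq_mul_le hSig.posSemidef Δ
    set F := l2NormSq ((R * X) *ᵥ Δ)
    set q := Δ ⬝ᵥ Sig *ᵥ Δ
    have h1 : 0 ≤ m * (F - gam R * n * q
        + 336 / 5 * Real.log p * sigmaMaxSq Sig * l1Norm Δ ^ 2) := by
      have : 7 / 5 * (gam R * n) * sigmaMaxSq Sig * l1Norm Δ ^ 2
          ≤ 7 / 5 * (m * (48 * Real.log p)) * sigmaMaxSq Sig * l1Norm Δ ^ 2 := by gcongr
      linarith
    have h2 := nonneg_of_mul_nonneg_right h1 hm0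
    have h3 : gam R * n * (etaMin (CFC.sqrt Sig) ^ 2 * l2NormSq Δ) ≤ gam R * n * q :=
      mul_le_mul_of_nonneg_left hform hg0.le
    rw [le_div_iff₀ hn0]
    have e : (gam R * etaMin (CFC.sqrt Sig) ^ 2 * l2NormSq Δ
        - 336 / 5 * (sigmaMaxSq Sig * (Real.log p / n)) * l1Norm Δ ^ 2) * n
        = gam R * n * (etaMin (CFC.sqrt Sig) ^ 2 * l2NormSq Δ)
          - 336 / 5 * Real.log p * sigmaMaxSq Sig * l1Norm Δ ^ 2 := by
      field_simp
    rw [e]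
    linarith
  · unfold kap
    -- Equivalent to (2γ - 1)(γ - 2) ≤ 0, that is, 1/2 ≤ γ ≤ 2.
    have h1 : 64 / 9 * ((2 : ℝ)⁻¹ ^ 5 * (1 + gam R) ^ 2) ≤ gam R := by nlinarith
    have := mul_le_mul_of_nonneg_right h1 (sq_nonneg (etaMin (CFC.sqrt Sig)))
    linarith
  · rw [del_sq (by exact_mod_cast (by omega : 1 ≤ p))]
    have h1 : 0 ≤ sigmaMaxSq Sig * (Real.log p / n) := by positivity
    refine (mul_le_mul_of_nonneg_right hS h1).trans_eq ?_
    field_simp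
    norm_num

end GLSLasso

theorem mainTheorem1 :
    ∃ c : ℝ, 0 < c ∧
      ∀ {Ω : Type*} [MeasurableSpace Ω] (P : Measure Ω) [IsProbabilityMeasure P]
        (n p : ℕ) (_hp : 2 ≤ p)
        -- the random design, the random innovations and their Gaussian laws
        (X : Ω → Matrix (Fin n) (Fin p) ℝ) (u : Ω → Fin n → ℝ)
        (Sig : Matrix (Fin p) (Fin p) ℝ) (_hSig : Sig.PosDef)
        (sigu : NNReal) (_hsigu : 0 < sigu)
        (_hX : GLSLasso.IsGaussianDesign P X Sig) (_hu : GLSLasso.IsGaussianNoise P u sigu)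
        (_hXu : IndepFun (fun ω i j => X ω i j) u P)
        -- the regression `y = X β₀ + L₀ u` and the known whitening matrix `R = L₀⁻¹`
        (β₀ : Fin p → ℝ) (L₀ R : Matrix (Fin n) (Fin n) ℝ) (_hL₀ : IsUnit L₀.det)
        (_hR : R = L₀⁻¹) (y : Ω → Fin n → ℝ) (_hy : ∀ ω, y ω = X ω *ᵥ β₀ + L₀ *ᵥ u ω)
        -- normalization of the whitening matrix
        (_hγ : 1 / 2 ≤ GLSLasso.gam R) (_hR2 : GLSLasso.opNorm R ≤ 2)
        -- the regularizer, the support set and the sample size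
        (τ : ℝ) (_hτ : 1 < τ) (lam : ℝ)
        (_hlam : 4 / √c * GLSLasso.subGaussianK P X u * GLSLasso.del n ((p : ℝ) ^ τ) ≤ lam)
        (S : Finset (Fin p))
        (_hS : (S.card : ℝ) ≤ (3 : ℝ)⁻¹ ^ 2 * (2 : ℝ)⁻¹ ^ 5 * (GLSLasso.sigmaMaxSq Sig)⁻¹ *
          GLSLasso.kap R Sig * (Real.log p)⁻¹ * n)
        (_hn : GLSLasso.opNorm R ^ 2 * (τ * Real.log p) *
          max ((3 : ℝ) ^ 2 * 2 ^ 3) ((2 : ℝ)⁻¹ ^ 2 * c⁻¹) ≤ n),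
        1 - 8 * (p : ℝ) ^ (1 - τ) <
          P.real {ω | ∀ β : Fin p → ℝ, GLSLasso.IsGLSLasso R (y ω) (X ω) lam β →
            GLSLasso.l2NormSq (β - β₀) ≤
              27 * S.card * lam ^ 2 / (8 * GLSLasso.kap R Sig ^ 2)
              + lam * GLSLasso.l1Norm (GLSLasso.restrict Sᶜ β₀) / GLSLasso.kap R Sig
              + 144 / GLSLasso.kap R Sig * GLSLasso.sigmaMaxSq Sig * GLSLasso.del n p ^ 2
                * GLSLasso.l1Norm (GLSLasso.restrict Sᶜ β₀) ^ 2} := by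
  -- This makes 4/√c = 400 and 1/(4c) = 2500, the constants required by the noise and tail bounds.
  refine ⟨1 / 10000, by norm_num, ?_⟩
  intro Ω _ P _ n p hp X u Sig hSig sigu hsigu hX hu hXu β₀ L₀ R hL₀ hR y hy hγ hR2 τ hτ lam hlam S
    hS hn
  have hn0 := GLSLasso.ne_zero_of_half_le_gam hγ
  have hl : 0 < Real.log p := Real.log_pos (by exact_mod_cast hp)
  have hp0 : (0 : ℝ) < p := by positivity
  have hRL : R * L₀ = 1 := by rw [hR, Matrix.nonsing_inv_mul _ hL₀]
  have hR1 : 1 ≤ GLSLasso.opNorm R ^ 2 := by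
    linarith [GLSLasso.two_mul_gam_le_opNorm_sq hn0 R]
  have hτl : 0 < τ * Real.log p := by positivity
  have hlarge : 2500 * (τ * Real.log p) ≤ n := by
    rw [max_eq_right (by norm_num)] at hn
    have := mul_le_mul_of_nonneg_right hR1 hτl.le
    linarith
  have hc : 4 / √(1 / 10000 : ℝ) = 400 := by
    rw [show (1 / 10000 : ℝ) = (1 / 100) ^ 2 by norm_num, Real.sqrt_sq (by norm_num)]
    norm_num
  rw [hc] at hlam
  have hδ : 0 < GLSLasso.del n ((p : ℝ) ^ τ) := by
    rw [GLSLasso.del, Real.log_rpow hp0]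
    exact Real.sqrt_pos.2 (div_pos hτl (by exact_mod_cast Nat.pos_of_ne_zero hn0))
  have hlam' : ∀ j, 400 * (√(Sig j j) * sigu) * GLSLasso.del n ((p : ℝ) ^ τ) ≤ lam := by
    intro j
    have := GLSLasso.sqrt_mul_le_subGaussianK hn0 hSig hX hsigu hu j
    refine le_trans ?_ hlam
    gcongr
  have hlam0 : 0 < lam := by
    refine lt_of_lt_of_le ?_ (hlam' ⟨0, by omega⟩)
    have h1 : 0 < √(Sig ⟨0, by omega⟩ ⟨0, by omega⟩) := Real.sqrt_pos.2 hSig.diag_pos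
    have h2 : (0 : ℝ) < sigu := by exact_mod_cast hsigu
    positivity
  have hb1 := GLSLasso.measure_exists_l2NormSq_lt_le hp hSig hX hγ hR2 hτ hlarge
  have hb2 := GLSLasso.measure_exists_lt_l2NormSq_le hp hSig hX hγ hR2 hlarge
  have hb3 := GLSLasso.measure_exists_lt_abs_dotProduct_le hp hSig hX hγ hR2 hτ hlarge hsigu hu hXu
    hlam'
  have hr : 0 < (p : ℝ) ^ (1 - τ) := Real.rpow_pos_of_pos hp0 _
  -- The three bad events cost 1 + 1 + 2 = 4 multiples of p^(1 - τ); 4 < 8 gives the strict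
  -- inequality.
  refine GLSLasso.one_sub_lt_measureReal (b := 4 * (p : ℝ) ^ (1 - τ)) ?_ (by positivity)
    (by linarith) ((measure_union_le _ _).trans
      ((add_le_add ((measure_union_le _ _).trans (add_le_add hb1 hb2)) hb3).trans_eq ?_))
  · intro ω hω β hβ
    simp only [Set.mem_compl_iff, Set.mem_union, Set.mem_iUnion, Set.mem_ofPred_eq, not_or,
      not_exists, not_lt] at hω
    rw [hy ω] at hβ
    exact GLSLasso.l2NormSq_sub_le_of_isGLSLasso hp hRL hγ hR2 hSig hlam0 hS hω.1.1 hω.1.2 hω.2 hβ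
  · rw [← ENNReal.ofReal_add (by positivity) (by positivity),
      ← ENNReal.ofReal_add (by positivity) (by positivity)]
    congr 1
    ring
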